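/- Let $k$ be a field of characteristic zero, $A$ an associative unital $k$-algebra and $\phi:A\to k$ a linear form with $\phi(1_A)=1$. Let $T(A)=\bigoplus_{n>0}A^{\otimes n}$, with elements of $A^{\otimes n}$ written as words $a_1\cdots a_n$, and let $H=\overline T(T(A))=\bigoplus_{m\ge 0}T(A)^{\otimes m}$ be the unital tensor algebra over $T(A)$, with unit $\mathbf 1$ and product written $x|y$. Let $\epsilon:H\to k$ be the canonical projection on degree zero, and let $\Delta:H\to H\otimes H$ be the algebra morphism with $$\Delta(a_1\cdots a_n)=\sum_{S\subseteq[n]}a_S\otimes a_{J_1}|\cdots|a_{J_l},$$ where $a_S=a_{s_1}\cdots a_{s_p}$ for $S=\{s_1<\cdots<s_p\}$, $a_\emptyset=\mathbf 1$, and $J_1,\dots,J_l$ are, from left to right, the maximal intervals of consecutive elements of $[n]\setminus S$. For linear forms $f,g$ on $H$ put $f*g=m_k\circ(f\otimes g)\circ\Delta$, $f^{*0}=\epsilon$, $f^{*(j+1)}=f^{*j}*f$. For $\alpha(\mathbf 1)=0$ and $f(\mathbf 1)=1$ put $$\exp^*(\alpha)=\sum_{j\ge0}\frac1{j!}\alpha^{*j},\qquad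 \log^*(f)=\sum_{l\ge1}\frac{(-1)^{l-1}}{l}(f-\epsilon)^{*l}$$ (finite sums at each element of $H$). A linear form $\kappa$ on $H$ is an infinitesimal character if $\kappa(\mathbf 1)=0$ and $\kappa(x|y)=0$ for all $x,y\in\ker\epsilon$. For a non-crossing partition $\gamma$ of $[n]$ and blocks $P,Q$ of $\gamma$ write $P\le Q$ if there are $a,b\in P$ and $c\in Q$ with $a\le c\le b$. Let $|\gamma|$ be the number of blocks. A monotone labelling of $\gamma$ is a numbering of its blocks by $1,\dots,|\gamma|$ which is increasing for $\le$; $\mathrm m(\gamma)$ is the number of monotone labellings; a monotone partition is a non-crossing partition with a monotone labelling. The tree factorial of the nesting forest of $\gamma$ is $\tau(\gamma)!=\prod_{P\in\gamma}|\{Q\in\gamma: P\le Q\}|$. For a family $(h_n)_{n\ge1}$ of $n$-linear forms on $A$ put $h_\gamma(a_1,\dots,a_n)=\prod_{P\in\gamma}h_{|P|}(a_P)$. The multivariate monotone cumulants of $(A,\phi)$ are the $n$-linear forms $h_n$, $n\ge1$, with $\phi(a_1\cdot_A\cdots\cdot_A a_n)=\sum_{(\gamma,\lambda)}\frac1{|\gamma|!}h_\gamma(a_1,\dots,a_n)$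 for all $n\geq 1$ and $a_1,\dots,a_n\in A$, the sum being over the monotone partitions of $[n]$. Let $\Phi:H\to k$ be the character (algebra morphism) with $\Phi(a_1\cdots a_n)=\phi(a_1\cdot_A\cdots\cdot_A a_n)$ on words, and let $\rho=\log^*(\Phi)$. Then: 1. $\rho$ is an infinitesimal character with $\exp^*(\rho)=\Phi$, and it is the only one. 2. With $h_n(a_1,\dots,a_n)=\rho(a_1\cdots a_n)$, for every $n\ge1$ and every word $w=a_1\cdots a_n$, $$\Phi(w)=\sum_{s=1}^n\frac1{s!}\sum_{\gamma\in\mathcal{NC}_n^s}\mathrm m(\gamma)\,h_\gamma(a_1,\dots,a_n)=\sum_{\gamma\in\mathcal{NC}_n}\frac1{\tau(\gamma)!}\,h_\gamma(a_1,\dots,a_n),$$ where $\mathcal{NC}_n$ is the set of non-crossing partitions of $[n]$ and $\mathcal{NC}_n^s$ the subset of those with $s$ blocks. 3. The forms $h_n$, $n\ge1$, are multivariate monotone cumulants of $(A,\phi)$, and they are the only family of multilinear forms with this property. -/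

import Mathlib

open scoped TensorProduct DirectSum

namespace MonotoneCumulants

noncomputable section

/-! ## The double tensor algebra -/

/-- The non-unital tensor algebra `T(A) = ⨁_{n > 0} A^{⊗ n}`; the summand of index `n` is
`A^{⊗ (n + 1)}`. -/
abbrev WordSpace (k A : Type*) [Field k] [Ring A] [Algebra k A] : Type _ :=
  ⨁ n : ℕ, ⨂[k]^(n + 1) A

/-- The double tensor algebra `H`, the unital tensor algebra over `T(A)`. Its product is the
concatenation product written with bars. -/
abbrev DoubleTensorAlgebra (k A : Type*) [Field k] [Ring A] [Algebra k A] : Type _ :=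
  TensorAlgebra k (WordSpace k A)

section

variable (k : Type*) {A : Type*} [Field k] [Ring A] [Algebra k A]

/-- The word `a₁ ⋯ aₙ`, seen in the double tensor algebra; the empty word is its unit. -/
def word : (n : ℕ) → MultilinearMap k (fun _ : Fin n => A) (DoubleTensorAlgebra k A)
  | 0 => MultilinearMap.constOfIsEmpty k _ 1
  | n + 1 =>
    (TensorAlgebra.ι k ∘ₗ DirectSum.lof k ℕ (fun m : ℕ => ⨂[k]^(m + 1) A) n).compMultilinearMap
      (PiTensorProduct.tprod k)

end

/-- The letters `a_{s₁}, …, a_{s_p}` of `a` at the positions `S = {s₁ < ⋯ < s_p}`. -/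
def letters {A : Type*} {n : ℕ} (a : Fin n → A) (S : Finset (Fin n)) : Fin S.card → A :=
  fun i => a (S.orderEmbOfFin rfl i)

theorem letters_update_of_notMem {A : Type*} {n : ℕ} (a : Fin n → A) {S : Finset (Fin n)} {i : Fin n}
    (hi : i ∉ S) (x : A) : letters (Function.update a i x) S = letters a S := by
  funext j
  refine Function.update_of_ne ?_ _ _
  rintro rfl
  exact hi (S.orderEmbOfFin_mem rfl j)

theorem letters_update_of_mem {A : Type*} {n : ℕ} (a : Fin n → A) {S : Finset (Fin n)} {i : Fin n}
    (hi : i ∈ S) : ∃ j, ∀ x, letters (Function.update a i x) S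
      = Function.update (letters a S) j x := by
  have : i ∈ Set.range (S.orderEmbOfFin rfl) := by simpa using hi
  obtain ⟨j, rfl⟩ := this
  refine ⟨j, fun x => ?_⟩
  exact Function.update_comp_eq_of_injective a (S.orderEmbOfFin rfl).injective j x

/-- The first elements of the connected components of `T ⊆ [n]`. -/
def starts {n : ℕ} (T : Finset (Fin n)) : Finset (Fin n) :=
  T.filter fun i => ∀ j ∈ T, (j : ℕ) + 1 ≠ i

/-- The maximal sequence of successive elements of `T` which begins at `i`. -/
def run {n : ℕ} (T : Finset (Fin n)) (i : Fin n) : Finset (Fin n) :=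
  T.filter fun j => i ≤ j ∧ Finset.Icc i j ⊆ T

/-- The connected components of `T` in `[n]`, listed from left to right. -/
def components {n : ℕ} (T : Finset (Fin n)) : List (Finset (Fin n)) :=
  ((starts T).sort (· ≤ ·)).map (run T)

theorem exists_mem_components {n : ℕ} {T : Finset (Fin n)} {i : Fin n} (hi : i ∈ T) :
    ∃ J ∈ components T, i ∈ J := by
  classical
  let C : Finset (Fin n) := T.filter fun j => j ≤ i ∧ Finset.Icc j i ⊆ T
  have hC : C.Nonempty := ⟨i, by simp [C, hi]⟩
  obtain ⟨hm, hmin⟩ := C.isLeast_min' hC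
  set s := C.min' hC with hs
  have hm' : s ∈ T ∧ s ≤ i ∧ Finset.Icc s i ⊆ T := by simpa [C] using hm
  refine ⟨run T s, ?_, by simp [run, hi, hm'.2.1, hm'.2.2]⟩
  refine List.mem_map.2 ⟨s, ?_, rfl⟩
  rw [Finset.mem_sort]
  simp only [starts, Finset.mem_filter]
  refine ⟨hm'.1, fun j hj hjs => ?_⟩
  have hjC : j ∈ C := by
    simp only [C, Finset.mem_filter]
    refine ⟨hj, ?_, fun x hx => ?_⟩
    · have := hm'.2.1
      rw [Fin.le_def] at *
      omega
    · rw [Finset.mem_Icc] at hx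
      by_cases hxj : x = j
      · rwa [hxj]
      · apply hm'.2.2
        rw [Finset.mem_Icc]
        refine ⟨?_, hx.2⟩
        have h1 := hx.1
        rw [Fin.le_def] at *
        have : (x : ℕ) ≠ j := fun h => hxj (Fin.ext h)
        omega
  have := hmin hjC
  rw [Fin.le_def] at this
  omega

theorem components_subset {n : ℕ} {T J : Finset (Fin n)} (hJ : J ∈ components T) : J ⊆ T := by
  obtain ⟨s, -, rfl⟩ := List.mem_map.1 hJ
  exact Finset.filter_subset _ _

theorem run_disjoint {n : ℕ} {T : Finset (Fin n)} {s t : Fin n} (ht : t ∈ starts T)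
    (hst : s < t) : Disjoint (run T s) (run T t) := by
  rw [Finset.disjoint_left]
  intro x hx hx'
  simp only [run, Finset.mem_filter] at hx hx'
  simp only [starts, Finset.mem_filter] at ht
  have htx := hx'.2.1
  rw [Fin.lt_def] at hst
  rw [Fin.le_def] at htx
  have hlt : (t : ℕ) - 1 < n := by omega
  refine ht.2 ⟨t - 1, hlt⟩ (hx.2.2 ?_) ?_
  · rw [Finset.mem_Icc, Fin.le_def, Fin.le_def]
    simp only
    omega
  · simp only
    omega

theorem components_pairwise {n : ℕ} (T : Finset (Fin n)) :
    (components T).Pairwise Disjoint := by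
  unfold components
  rw [List.pairwise_map]
  have h := (starts T).sortedLT_sort
  refine List.Pairwise.imp_of_mem ?_ h.pairwise
  intro s t _ ht hst
  exact run_disjoint ((Finset.mem_sort _).1 ht) hst

section

variable (k : Type*) {A : Type*} [Field k] [Ring A] [Algebra k A]

/-- The word `a_S = a_{s₁} ⋯ a_{s_p}` for `S = {s₁ < ⋯ < s_p}`; it is `1` for empty `S`. -/
def subword {n : ℕ} (a : Fin n → A) (S : Finset (Fin n)) : DoubleTensorAlgebra k A :=
  word k S.card (letters a S)

/-- The element `a_{J₁} | ⋯ | a_{J_l}`, with `J₁, …, J_l` the connected components of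
`[n] - S`. -/
def complementBar {n : ℕ} (a : Fin n → A) (S : Finset (Fin n)) : DoubleTensorAlgebra k A :=
  ((components Sᶜ).map (subword k a)).prod

variable {k}

theorem subword_update_of_notMem {n : ℕ} (a : Fin n → A) {S : Finset (Fin n)} {i : Fin n}
    (hi : i ∉ S) (x : A) : subword k (Function.update a i x) S = subword k a S := by
  rw [subword, letters_update_of_notMem a hi, subword]

theorem subword_update_add {n : ℕ} (a : Fin n → A) {S : Finset (Fin n)} {i : Fin n}
    (hi : i ∈ S) (x y : A) : subword k (Function.update a i (x + y)) S
      = subword k (Function.update a i x) S + subword k (Function.update a i y) S := by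
  obtain ⟨j, hj⟩ := letters_update_of_mem a hi
  simp only [subword, hj, MultilinearMap.map_update_add]

theorem subword_update_smul {n : ℕ} (a : Fin n → A) {S : Finset (Fin n)} {i : Fin n}
    (hi : i ∈ S) (c : k) (x : A) : subword k (Function.update a i (c • x)) S
      = c • subword k (Function.update a i x) S := by
  obtain ⟨j, hj⟩ := letters_update_of_mem a hi
  simp only [subword, hj, MultilinearMap.map_update_smul]

theorem bar_update_of_notMem {n : ℕ} (a : Fin n → A) {L : List (Finset (Fin n))} {i : Fin n}
    (hi : ∀ J ∈ L, i ∉ J) (x : A) :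
    (L.map (subword k (Function.update a i x))).prod = (L.map (subword k a)).prod := by
  congr 1
  exact List.map_congr_left fun J hJ => subword_update_of_notMem a (hi J hJ) x

theorem bar_update_add {n : ℕ} (a : Fin n → A) {L : List (Finset (Fin n))} {i : Fin n}
    (hL : L.Pairwise Disjoint) (hi : ∃ J ∈ L, i ∈ J) (x y : A) :
    (L.map (subword k (Function.update a i (x + y)))).prod
      = (L.map (subword k (Function.update a i x))).prod
        + (L.map (subword k (Function.update a i y))).prod := by
  induction L with
  | nil => simp at hi
  | cons J L ih =>
    rw [List.pairwise_cons] at hL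
    simp only [List.map_cons, List.prod_cons]
    by_cases hJ : i ∈ J
    · have hn : ∀ K ∈ L, i ∉ K := fun K hK => Finset.disjoint_left.1 (hL.1 K hK) hJ
      simp only [bar_update_of_notMem a hn, subword_update_add a hJ, add_mul]
    · have hi' : ∃ K ∈ L, i ∈ K := by simpa [hJ] using hi
      simp only [subword_update_of_notMem a hJ, ih hL.2 hi', mul_add]

theorem bar_update_smul {n : ℕ} (a : Fin n → A) {L : List (Finset (Fin n))} {i : Fin n}
    (hL : L.Pairwise Disjoint) (hi : ∃ J ∈ L, i ∈ J) (c : k) (x : A) :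
    (L.map (subword k (Function.update a i (c • x)))).prod
      = c • (L.map (subword k (Function.update a i x))).prod := by
  induction L with
  | nil => simp at hi
  | cons J L ih =>
    rw [List.pairwise_cons] at hL
    simp only [List.map_cons, List.prod_cons]
    by_cases hJ : i ∈ J
    · have hn : ∀ K ∈ L, i ∉ K := fun K hK => Finset.disjoint_left.1 (hL.1 K hK) hJ
      simp only [bar_update_of_notMem a hn, subword_update_smul a hJ, smul_mul_assoc]
    · have hi' : ∃ K ∈ L, i ∈ K := by simpa [hJ] using hi
      simp only [subword_update_of_notMem a hJ, ih hL.2 hi', mul_smul_comm]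

variable (k)

/-- The term `a_S ⊗ a_{J₁} | ⋯ | a_{J_l}` of the coproduct of `a₁ ⋯ aₙ`, as a multilinear map. -/
def coproductTerm {n : ℕ} (S : Finset (Fin n)) :
    MultilinearMap k (fun _ : Fin n => A)
      (DoubleTensorAlgebra k A ⊗[k] DoubleTensorAlgebra k A) where
  toFun a := subword k a S ⊗ₜ[k] complementBar k a S
  map_update_add' {inst} a i x y := by
    obtain rfl : inst = instDecidableEqFin n := Subsingleton.elim _ _
    by_cases hi : i ∈ S
    · have hn : ∀ J ∈ components Sᶜ, i ∉ J := fun J hJ h =>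
        (Finset.mem_compl.1 (components_subset hJ h)) hi
      simp only [complementBar, bar_update_of_notMem a hn, subword_update_add a hi,
        TensorProduct.add_tmul]
    · have he := exists_mem_components (Finset.mem_compl.2 hi)
      simp only [complementBar, subword_update_of_notMem a hi,
        bar_update_add a (components_pairwise _) he, TensorProduct.tmul_add]
  map_update_smul' {inst} a i c x := by
    obtain rfl : inst = instDecidableEqFin n := Subsingleton.elim _ _
    by_cases hi : i ∈ S
    · have hn : ∀ J ∈ components Sᶜ, i ∉ J := fun J hJ h =>
        (Finset.mem_compl.1 (components_subset hJ h)) hi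
      simp only [complementBar, bar_update_of_notMem a hn, subword_update_smul a hi,
        TensorProduct.smul_tmul']
    · have he := exists_mem_components (Finset.mem_compl.2 hi)
      simp only [complementBar, subword_update_of_notMem a hi,
        bar_update_smul a (components_pairwise _) he, TensorProduct.tmul_smul]

variable (A)

/-- The coproduct of `H`: `Δ(a₁ ⋯ aₙ) = ∑_{S ⊆ [n]} a_S ⊗ a_{J₁} | ⋯ | a_{J_l}` on words,
extended multiplicatively. -/
def coproduct : DoubleTensorAlgebra k A →ₐ[k]
    DoubleTensorAlgebra k A ⊗[k] DoubleTensorAlgebra k A :=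
  TensorAlgebra.lift k (DirectSum.toModule k ℕ _ fun n : ℕ =>
    PiTensorProduct.lift (∑ S : Finset (Fin (n + 1)), coproductTerm k S))

/-- The counit of `H`: the canonical projection on the component `k` of degree zero. -/
def counit : DoubleTensorAlgebra k A →ₐ[k] k :=
  TensorAlgebra.algebraMapInv

variable {k A}

/-! ## Convolution, exponential and logarithm -/

/-- The convolution product `f * g = m_k ∘ (f ⊗ g) ∘ Δ` on `Lin(H, k)`. -/
def conv (f g : DoubleTensorAlgebra k A →ₗ[k] k) : DoubleTensorAlgebra k A →ₗ[k] k :=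
  LinearMap.mul' k k ∘ₗ TensorProduct.map f g ∘ₗ (coproduct k A).toLinearMap

/-- The convolution power `f^{* j}`; `f^{* 0}` is the counit, the unit for convolution. -/
def convPow (f : DoubleTensorAlgebra k A →ₗ[k] k) : ℕ → DoubleTensorAlgebra k A →ₗ[k] k
  | 0 => (counit k A).toLinearMap
  | j + 1 => conv (convPow f j) f

open Classical in
/-- The sum of a sequence of linear forms on `H` of which only finitely many are nonzero at any
given element of `H` (and `0` for a sequence without this property). -/
def pointwiseSum (f : ℕ → DoubleTensorAlgebra k A →ₗ[k] k) : DoubleTensorAlgebra k A →ₗ[k] k :=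
  if hf : ∀ x, (Function.support fun j => f j x).Finite then
    { toFun := fun x => ∑ᶠ j, f j x
      map_add' := fun x y => by
        simp only [map_add]
        exact finsum_add_distrib (hf x) (hf y)
      map_smul' := fun c x => by
        simp only [map_smul, RingHom.id_apply]
        exact (smul_finsum c _).symm }
  else 0

/-- The shuffle exponential `exp^*(α) = ∑_{j ≥ 0} α^{* j} / j!`. -/
def convExp (α : DoubleTensorAlgebra k A →ₗ[k] k) : DoubleTensorAlgebra k A →ₗ[k] k :=
  pointwiseSum fun j => ((j.factorial : k)⁻¹) • convPow α j

/-- The shuffle logarithm `log^*(ε + γ) = ∑_{l ≥ 1} (-1)^{l-1} γ^{* l} / l`, as a function of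
`f = ε + γ`; the summation index is `j = l - 1`. -/
def convLog (f : DoubleTensorAlgebra k A →ₗ[k] k) : DoubleTensorAlgebra k A →ₗ[k] k :=
  pointwiseSum fun j =>
    ((-1 : k) ^ j / ((j : k) + 1)) • convPow (f - (counit k A).toLinearMap) (j + 1)

/-- Infinitesimal characters: `κ(1) = 0` and `κ(x | y) = 0` for `x`, `y` in the kernel `H⁺` of
the counit. -/
def IsInfinitesimalCharacter (κ : DoubleTensorAlgebra k A →ₗ[k] k) : Prop :=
  κ 1 = 0 ∧ ∀ x y, counit k A x = 0 → counit k A y = 0 → κ (x * y) = 0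

/-- The character `Φ` of `H` with `Φ(w₁ | ⋯ | w_m) = φ(w₁) ⋯ φ(w_m)`, where
`φ(a₁ ⋯ aₙ)` is the value of `φ` at the product of the `a_i` in `A`. -/
def momentCharacter (φ : A →ₗ[k] k) : DoubleTensorAlgebra k A →ₐ[k] k :=
  TensorAlgebra.lift k (DirectSum.toModule k ℕ k fun n : ℕ =>
    PiTensorProduct.lift (φ.compMultilinearMap (MultilinearMap.mkPiAlgebraFin k (n + 1) A)))

end

/-! ## Non-crossing and monotone partitions -/

/-- Set partitions of `[n]`. -/
abbrev SetPartition (n : ℕ) : Type :=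
  Finpartition (Finset.univ : Finset (Fin n))

/-- No `i < j < l < m` with `i`, `l` in one block and `j`, `m` in another one. -/
def IsNonCrossing {n : ℕ} (π : SetPartition n) : Prop :=
  ∀ P ∈ π.parts, ∀ Q ∈ π.parts, P ≠ Q →
    ¬ ∃ i ∈ P, ∃ l ∈ P, ∃ j ∈ Q, ∃ m ∈ Q, i < j ∧ j < l ∧ l < m

open Classical in
/-- The set `NC_n` of non-crossing partitions of `[n]`. -/
def nonCrossingPartitions (n : ℕ) : Finset (SetPartition n) :=
  Finset.univ.filter IsNonCrossing

/-- The nesting preorder of blocks: `Q ≥ P` if some element of `Q` lies between two elements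
of `P`. -/
def NestedLE {n : ℕ} (P Q : Finset (Fin n)) : Prop :=
  ∃ a ∈ P, ∃ b ∈ P, ∃ c ∈ Q, a ≤ c ∧ c ≤ b

/-- A monotone labelling of the blocks: a numbering by `1, …, s` (here `0, …, s - 1`), where `s`
is the number of blocks, which is increasing for the nesting order. -/
def MonotoneLabelling {n : ℕ} (π : SetPartition n) : Type :=
  { e : {P // P ∈ π.parts} ≃ Fin π.parts.card //
    ∀ P Q : {P // P ∈ π.parts}, NestedLE P.1 Q.1 → e P ≤ e Q }

open Classical in
instance {n : ℕ} (π : SetPartition n) : Fintype (MonotoneLabelling π) :=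
  inferInstanceAs (Fintype { e : {P // P ∈ π.parts} ≃ Fin π.parts.card //
    ∀ P Q : {P // P ∈ π.parts}, NestedLE P.1 Q.1 → e P ≤ e Q })

/-- The number `m(π)` of monotone labellings of `π`. -/
def monotoneLabellingCount {n : ℕ} (π : SetPartition n) : ℕ :=
  Fintype.card (MonotoneLabelling π)

open Classical in
/-- The tree factorial `τ(π)!` of the nesting forest of a non-crossing partition. The vertices
of this forest are the blocks, the blocks in the subtree with root `P` are those nested in `P`
(with `P` itself), and the tree factorial of a forest is the product over all its vertices of the
number of vertices of the subtree rooted there. -/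
def treeFactorial {n : ℕ} (π : SetPartition n) : ℕ :=
  ∏ P ∈ π.parts, (π.parts.filter fun Q => NestedLE P Q).card

section

variable {k A : Type*} [Field k] [Ring A] [Algebra k A]

/-- For multilinear forms `h_n` on `A`, the product `h_π(a₁, …, aₙ) = ∏_{P ∈ π} h_{|P|}(a_P)`
over the blocks of `π`. -/
def blockProduct (h : (n : ℕ) → MultilinearMap k (fun _ : Fin n => A) k) {n : ℕ}
    (π : SetPartition n) (a : Fin n → A) : k :=
  ∏ P ∈ π.parts, h P.card (letters a P)

/-- The multilinear forms `h_n(a₁, …, aₙ) = ρ(a₁ ⋯ aₙ)`. -/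
def formsOf (ρ : DoubleTensorAlgebra k A →ₗ[k] k) (n : ℕ) :
    MultilinearMap k (fun _ : Fin n => A) k :=
  ρ.compMultilinearMap (word k n)

/-- `h_n`, `n ≥ 1`, are the multivariate monotone cumulants of `φ`: the moments of `φ` are the
sums `∑ h_π / |π|!` over all monotone partitions `(π, e)`, that is, over all non-crossing
partitions `π` with a monotone labelling `e`. The form `h_0` is irrelevant. -/
def IsMonotoneCumulantFamily (φ : A →ₗ[k] k)
    (h : (n : ℕ) → MultilinearMap k (fun _ : Fin n => A) k) : Prop :=
  ∀ n : ℕ, 1 ≤ n → ∀ a : Fin n → A,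
    φ (List.ofFn a).prod =
      ∑ p ∈ (nonCrossingPartitions n).sigma fun π => (Finset.univ : Finset (MonotoneLabelling π)),
        ((p.1.parts.card.factorial : k)⁻¹) * blockProduct h p.1 a

end

end

end MonotoneCumulants

/-!
The linear forms on `H` form a ring under convolution, and a form `γ` with `γ(1) = 0` is locally
nilpotent in it, as the coproduct preserves the number of letters.

Associativity is seen in a larger bialgebra: the free algebra on the letters and a bar, with
`Δ(a) = a ⊗ | + 1 ⊗ a` and `Δ(|) = | ⊗ |`. Expanding `Δ(a₁) ⋯ Δ(aₙ)` gives the coproduct of `H`, as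
each letter which goes to the left leaves a bar on the right, and the bars cut the complement into its
connected components. Reading lists of letters and bars (`barred`) maps this free algebra onto `H`, so
a form on `H` is a function on such lists; the convolution of these (`listConv`) is defined by
recursion, and is associative for an evident reason (`conv_barred`, `listConv_assoc`).

Formal power series can then be evaluated at `γ`, which gives `exp^*(log^*(f)) = f`. At each `x ∈ H`
the powers `(exp^* α)^{* t}(x)` are the values at `t` of a polynomial with constant coefficient `ε(x)`
and linear coefficient `α(x)` (`exists_polynomial_convExp_pow`). So `exp^*` is injective; and if
`Φ = exp^*(ρ)` is a character, so are its powers, these polynomials are multiplicative in `x`, and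
comparing linear coefficients shows that `ρ` is an infinitesimal character.

Convolution with an infinitesimal character `α` on the right removes an interval from a word
(`conv_subword`). The power `α^{* s}` of a word is therefore a sum over the ways to remove `s` blocks
from it, each an interval of what is left at its removal. In reverse order these are the monotone
partitions with `s` blocks; the monotonicity of the labels alone implies that the partition is
non-crossing (`pow_word`). The two formulas for the moments agree by the hook length formula
`m(γ) τ(γ)! = |γ|!` for the nesting forest, proved by removing the root with the smallest label
(`card_linearExtension_mul_prod`). Monotone cumulants are unique as the moment of order `n` is the
cumulant of order `n` plus a function of cumulants of smaller order.
-/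

namespace MonotoneCumulants

noncomputable section

/-! ### Words with bars -/

section

variable (k : Type*) {A : Type*} [Field k] [Ring A] [Algebra k A]

/-- The word in `H` with the letters of a list. -/
def listWord (u : List A) : DoubleTensorAlgebra k A :=
  word k u.length u.get

/-- The element of `H` described by a list of letters and bars, where `none` is a bar. The first
argument holds the letters already read of the current word. A bar next to another bar or to an
end of the list has no effect, as the empty word is the unit of `H`. -/
def readBars : List A → List (Option A) → DoubleTensorAlgebra k A
  | u, [] => listWord k u
  | u, none :: l => listWord k u * readBars [] l
  | u, some a :: l => readBars (u ++ [a]) l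

/-- The element of `H` described by a list of letters and bars. -/
def barred (l : List (Option A)) : DoubleTensorAlgebra k A := readBars k [] l

variable {k}

theorem word_eq_listWord {n : ℕ} (a : Fin n → A) : word k n a = listWord k (List.ofFn a) := by
  have h : ∀ (m : ℕ) (hm : m = n) (b : Fin m → A), (∀ i, b i = a (Fin.cast hm i)) →
      word k n a = word k m b := by
    rintro m rfl b hb
    congr 1
    exact funext fun i => (hb i).symm
  exact h _ (List.length_ofFn) _ fun i => by simp [Fin.cast]

theorem listWord_nil : listWord k ([] : List A) = 1 := rfl

theorem readBars_append_none (u : List A) (l l' : List (Option A)) :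
    readBars k u (l ++ none :: l') = readBars k u l * barred k l' := by
  induction l generalizing u with
  | nil => simp [readBars, barred]
  | cons x l ih =>
    cases x with
    | none => simp [readBars, ih, mul_assoc]
    | some a => simp [readBars, ih]

theorem barred_append_none (l l' : List (Option A)) :
    barred k (l ++ none :: l') = barred k l * barred k l' :=
  readBars_append_none _ _ _

theorem barred_none_cons (l : List (Option A)) : barred k (none :: l) = barred k l := by
  simp [barred, readBars, listWord_nil]

theorem readBars_map_some (u v : List A) (l : List (Option A)) :
    readBars k u (v.map some ++ l) = readBars k (u ++ v) l := by
  induction v generalizing u with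
  | nil => simp
  | cons x v ih => simp [readBars, ih]

theorem barred_map_some (u : List A) : barred k (u.map some) = listWord k u := by
  simpa [barred, readBars] using readBars_map_some (k := k) [] u []

theorem span_range_barred : Submodule.span k (Set.range (barred k (A := A))) = ⊤ := by
  set M := Submodule.span k (Set.range (barred k (A := A))) with hM
  have hmul : ∀ x ∈ M, ∀ y ∈ M, x * y ∈ M := by
    intro x hx y hy
    have h : x * y ∈ M * M := Submodule.mul_mem_mul hx hy
    rw [hM, Submodule.span_mul_span] at h
    refine Submodule.span_mono ?_ h
    rintro _ ⟨_, ⟨l, rfl⟩, _, ⟨l', rfl⟩, rfl⟩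
    exact ⟨_, barred_append_none l l'⟩
  have hone : (1 : DoubleTensorAlgebra k A) ∈ M := Submodule.subset_span ⟨[], rfl⟩
  rw [eq_top_iff]
  rintro x -
  induction x using TensorAlgebra.induction with
  | algebraMap r => rw [Algebra.algebraMap_eq_smul_one]; exact M.smul_mem _ hone
  | mul x y hx hy => exact hmul x hx y hy
  | add x y hx hy => exact M.add_mem hx hy
  | ι w =>
    induction w using DirectSum.induction_on with
    | zero => simp
    | add x y hx hy => rw [map_add]; exact M.add_mem hx hy
    | of n t =>
      induction t using PiTensorProduct.induction_on with
      | smul_tprod r a =>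
        have : TensorAlgebra.ι k (DirectSum.of (fun m : ℕ => ⨂[k]^(m + 1) A) n
            (r • PiTensorProduct.tprod k a)) = r • word k (n + 1) a := by
          rw [← DirectSum.lof_eq_of k, map_smul, map_smul]
          rfl
        rw [this, word_eq_listWord, ← barred_map_some]
        exact M.smul_mem _ (Submodule.subset_span ⟨_, rfl⟩)
      | add x y hx hy => rw [map_add, map_add]; exact M.add_mem hx hy

theorem form_ext {f g : DoubleTensorAlgebra k A →ₗ[k] k}
    (h : ∀ l, f (barred k l) = g (barred k l)) : f = g :=
  LinearMap.ext_on span_range_barred (by rintro _ ⟨l, rfl⟩; exact h l)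

/-- The letters of `a` at the positions in the list `L`, with a bar in place of each letter at a
position outside `T`. -/
def maskBars {n : ℕ} (a : Fin n → A) (T : Finset (Fin n)) (L : List (Fin n)) : List (Option A) :=
  L.map fun i => if i ∈ T then some (a i) else none

theorem subword_eq {n : ℕ} (a : Fin n → A) (S : Finset (Fin n)) :
    subword k a S = listWord k (((List.finRange n).filter (· ∈ S)).map a) := by
  rw [subword, word_eq_listWord]
  congr 1
  have h : ((List.finRange n).filter (· ∈ S)) = S.sort (· ≤ ·) := by
    refine List.Perm.eq_of_pairwise (le := (· ≤ ·)) ?_ ?_ ?_ ?_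
    · exact fun a b _ _ h1 h2 => le_antisymm h1 h2
    · exact ((List.sortedLT_finRange n).pairwise.imp le_of_lt).filter _
    · exact Finset.pairwise_sort _ _
    · rw [List.perm_ext_iff_of_nodup ((List.nodup_finRange n).filter _) (Finset.sort_nodup _ _)]
      simp
  rw [h, ← Finset.listMap_orderEmbOfFin_finRange S rfl, List.ofFn_eq_map, List.map_map]
  rfl


theorem val_eq_length_of_finRange_eq {n : ℕ} {p L : List (Fin n)} {q : Fin n}
    (h : List.finRange n = p ++ q :: L) : (q : ℕ) = p.length := by
  have h1 : (List.finRange n)[p.length]? = some q := by rw [h]; simp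
  rw [List.getElem?_eq_some_iff] at h1
  obtain ⟨h2, h3⟩ := h1
  simp [← h3]

theorem mem_suffix_finRange {n : ℕ} {p L : List (Fin n)} {q : Fin n}
    (h : List.finRange n = p ++ q :: L) (x : Fin n) : x ∈ q :: L ↔ q ≤ x := by
  have hs := (List.sortedLT_finRange n).pairwise
  rw [h, List.pairwise_append] at hs
  have hx : x ∈ p ++ q :: L := h ▸ List.mem_finRange x
  constructor
  · intro hm
    rcases List.mem_cons.1 hm with rfl | hm
    · exact le_rfl
    · exact ((List.pairwise_cons.1 hs.2.1).1 x hm).le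
  · intro hq
    rcases List.mem_append.1 hx with hx | hx
    · exact absurd (hs.2.2 x hx q List.mem_cons_self) (not_lt.2 hq)
    · exact hx

theorem mem_takeWhile_of_pairwise_lt {n : ℕ} (P : Fin n → Prop) [DecidablePred P] {L : List (Fin n)}
    (hL : L.Pairwise (· < ·)) (x : Fin n) :
    x ∈ L.takeWhile (fun i => decide (P i)) ↔ x ∈ L ∧ ∀ y ∈ L, y ≤ x → P y := by
  induction L with
  | nil => simp
  | cons q L ih =>
    rw [List.pairwise_cons] at hL
    by_cases hq : P q
    · rw [List.takeWhile_cons_of_pos (by simpa using hq), List.mem_cons, ih hL.2]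
      constructor
      · rintro (rfl | ⟨h1, h2⟩)
        · refine ⟨List.mem_cons_self, fun y hy hyx => ?_⟩
          rcases List.mem_cons.1 hy with rfl | hy
          · exact hq
          · exact absurd (hL.1 y hy) (not_lt.2 hyx)
        · refine ⟨List.mem_cons_of_mem _ h1, fun y hy hyx => ?_⟩
          rcases List.mem_cons.1 hy with rfl | hy
          · exact hq
          · exact h2 y hy hyx
      · rintro ⟨h1, h2⟩
        rcases List.mem_cons.1 h1 with rfl | h1
        · exact Or.inl rfl
        · exact Or.inr ⟨h1, fun y hy => h2 y (List.mem_cons_of_mem _ hy)⟩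
    · rw [List.takeWhile_cons_of_neg (by simpa using hq)]
      simp only [List.not_mem_nil, false_iff, not_and, not_forall]
      intro h1
      refine ⟨q, List.mem_cons_self, ?_, hq⟩
      rcases List.mem_cons.1 h1 with rfl | h1
      · exact le_rfl
      · exact (hL.1 x h1).le

/-- The run which begins at `q` consists of the positions from `q` on before the first one outside
`T`. -/
theorem filter_mem_run {n : ℕ} {T : Finset (Fin n)} {p L : List (Fin n)} {q : Fin n}
    (h : List.finRange n = p ++ q :: L) :
    (List.finRange n).filter (· ∈ run T q) = (q :: L).takeWhile (· ∈ T) := by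
  have hs := (List.sortedLT_finRange n).pairwise
  have hs' : (q :: L).Pairwise (· < ·) := by
    rw [h, List.pairwise_append] at hs
    exact hs.2.1
  refine List.Perm.eq_of_pairwise (le := (· < ·)) ?_ (hs.filter _)
    (hs'.sublist (List.takeWhile_sublist _)) ?_
  · exact fun a b _ _ h1 h2 => absurd h2 h1.asymm
  · rw [List.perm_ext_iff_of_nodup ((List.nodup_finRange n).filter _)
      ((hs'.imp ne_of_lt).sublist (List.takeWhile_sublist _))]
    intro x
    rw [mem_takeWhile_of_pairwise_lt (· ∈ T) hs', mem_suffix_finRange h]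
    simp only [List.mem_filter, List.mem_finRange, true_and, run, Finset.mem_filter,
      decide_eq_true_eq, mem_suffix_finRange h]
    constructor
    · rintro ⟨-, h2, h3⟩
      exact ⟨h2, fun y h4 h5 => h3 (Finset.mem_Icc.2 ⟨h4, h5⟩)⟩
    · rintro ⟨h2, h3⟩
      exact ⟨h3 x h2 le_rfl, h2, fun y hy => h3 y (Finset.mem_Icc.1 hy).1 (Finset.mem_Icc.1 hy).2⟩

/-- Reading the letters at the positions in `T` from some position on: the letters up to the first
bar prolong the current word, and every later run of `T` gives a new word. -/
theorem readBars_maskBars {n : ℕ} (a : Fin n → A) (T : Finset (Fin n)) (L : List (Fin n)) :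
    ∀ (p : List (Fin n)) (_ : List.finRange n = p ++ L) (u : List A),
    readBars k u (maskBars a T L) = listWord k (u ++ (L.takeWhile (· ∈ T)).map a) *
      ((L.tail.filter (· ∈ starts T)).map fun s => subword k a (run T s)).prod := by
  induction L with
  | nil => intro p _ u; simp [maskBars, readBars]
  | cons i L ih =>
    intro p h u
    have h' : List.finRange n = (p ++ [i]) ++ L := by simp [h]
    have ih' := ih (p ++ [i]) h'
    by_cases hi : i ∈ T
    · have hm : maskBars a T (i :: L) = some (a i) :: maskBars a T L := by simp [maskBars, hi]
      rw [hm, readBars, ih', List.takeWhile_cons_of_pos (by simpa using hi)]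
      -- The position after an element of `T` does not begin a run.
      have : L.tail.filter (· ∈ starts T) = L.filter (· ∈ starts T) := by
        cases L with
        | nil => rfl
        | cons j L =>
          have hj : j ∉ starts T := by
            intro hj
            refine (Finset.mem_filter.1 hj).2 i hi ?_
            rw [val_eq_length_of_finRange_eq h, val_eq_length_of_finRange_eq h']
            simp
          rw [List.tail_cons, List.filter_cons_of_neg (by simpa using hj)]
      simp [this]
    · have hm : maskBars a T (i :: L) = none :: maskBars a T L := by simp [maskBars, hi]
      rw [hm, readBars, ih', List.takeWhile_cons_of_neg (by simpa using hi)]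
      simp only [List.map_nil, List.append_nil, List.nil_append, List.tail_cons]
      congr 1
      -- If the next position is in `T`, its run is the current word after this bar.
      cases L with
      | nil => simp [listWord_nil]
      | cons j L =>
        by_cases hj : j ∈ T
        · have hjs : j ∈ starts T := by
            refine Finset.mem_filter.2 ⟨hj, fun x hx hxj => hi ?_⟩
            rw [val_eq_length_of_finRange_eq h'] at hxj
            have : x = i := by
              apply Fin.ext
              rw [val_eq_length_of_finRange_eq h]
              simpa using hxj
            rwa [← this]
          rw [List.filter_cons_of_pos (by simpa using hjs), List.map_cons, List.prod_cons,
            subword_eq, filter_mem_run h', List.tail_cons]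
        · have hjs : j ∉ starts T := fun hjs => hj (Finset.mem_filter.1 hjs).1
          rw [List.filter_cons_of_neg (by simpa using hjs),
            List.takeWhile_cons_of_neg (by simpa using hj)]
          simp [listWord_nil]

/-- Replacing the letters at the positions in `S` by bars separates the connected components of the
complement of `S`. -/
theorem complementBar_eq {n : ℕ} (a : Fin n → A) (S : Finset (Fin n)) :
    complementBar k a S = barred k (maskBars a Sᶜ (List.finRange n)) := by
  have hsort : (starts Sᶜ).sort (· ≤ ·) = (List.finRange n).filter (· ∈ starts Sᶜ) := by
    refine List.Perm.eq_of_pairwise (le := (· ≤ ·)) ?_ (Finset.pairwise_sort _ _) ?_ ?_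
    · exact fun a b _ _ h1 h2 => le_antisymm h1 h2
    · exact ((List.sortedLT_finRange n).pairwise.imp le_of_lt).filter _
    · rw [List.perm_ext_iff_of_nodup (Finset.sort_nodup _ _) ((List.nodup_finRange n).filter _)]
      simp
  rw [complementBar, components, hsort, barred, readBars_maskBars a Sᶜ (List.finRange n) [] rfl [],
    List.map_map]
  generalize hL : List.finRange n = L
  cases L with
  | nil => simp [listWord_nil]
  | cons j L =>
    by_cases hj : j ∈ Sᶜ
    · have hjs : j ∈ starts Sᶜ := by
        refine Finset.mem_filter.2 ⟨hj, fun x hx hxj => ?_⟩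
        rw [val_eq_length_of_finRange_eq (p := []) hL] at hxj
        simp at hxj
      rw [List.filter_cons_of_pos (by simpa using hjs), List.map_cons, List.prod_cons,
        Function.comp_apply, subword_eq, filter_mem_run (p := []) hL]
      rfl
    · have hjs : j ∉ starts Sᶜ := fun hjs => hj (Finset.mem_filter.1 hjs).1
      rw [List.filter_cons_of_neg (by simpa using hjs),
        List.takeWhile_cons_of_neg (by simpa using hj)]
      simp [listWord_nil]
      rfl

end

/-! ### Convolution in terms of lists of letters and bars -/

section

variable {k A : Type*} [Field k]

/-- The convolution of functions on lists of letters and bars which is dual to the multiplicative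
coproduct with `a ↦ a ⊗ | + 1 ⊗ a` on letters and `| ↦ | ⊗ |` on bars. -/
def listConv : (F G : List (Option A) → k) → List (Option A) → k
  | F, G, [] => F [] * G []
  | F, G, none :: l => listConv (fun x => F (none :: x)) (fun y => G (none :: y)) l
  | F, G, some a :: l =>
    listConv (fun x => F (some a :: x)) (fun y => G (none :: y)) l +
      listConv F (fun y => G (some a :: y)) l

theorem listConv_add_left (F F' G : List (Option A) → k) (l : List (Option A)) :
    listConv (fun x => F x + F' x) G l = listConv F G l + listConv F' G l := by
  induction l generalizing F F' G with
  | nil => simp [listConv, add_mul]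
  | cons x l ih =>
    cases x with
    | none => simp only [listConv, ih]
    | some a => simp only [listConv, ih]; ring

theorem listConv_add_right (F G G' : List (Option A) → k) (l : List (Option A)) :
    listConv F (fun x => G x + G' x) l = listConv F G l + listConv F G' l := by
  induction l generalizing F G G' with
  | nil => simp [listConv, mul_add]
  | cons x l ih =>
    cases x with
    | none => simp only [listConv, ih]
    | some a => simp only [listConv, ih]; ring

/-- Associativity is immediate here, as it holds on each letter and on the bar. -/
theorem listConv_assoc (F G K : List (Option A) → k) (l : List (Option A)) :
    listConv (listConv F G) K l = listConv F (listConv G K) l := by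
  induction l generalizing F G K with
  | nil => simp [listConv, mul_assoc]
  | cons x l ih =>
    cases x with
    | none => exact ih _ _ _
    | some a =>
      have h1 : listConv (listConv F G) K (some a :: l) =
          listConv (fun x => listConv (fun x => F (some a :: x)) (fun y => G (none :: y)) x
            + listConv F (fun y => G (some a :: y)) x) (fun y => K (none :: y)) l
          + listConv (listConv F G) (fun y => K (some a :: y)) l := rfl
      have h2 : listConv F (listConv G K) (some a :: l) =
          listConv (fun x => F (some a :: x))
            (listConv (fun y => G (none :: y)) (fun y => K (none :: y))) l
          + listConv F (fun x => listConv (fun x => G (some a :: x)) (fun y => K (none :: y)) x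
            + listConv G (fun y => K (some a :: y)) x) l := rfl
      rw [h1, h2, listConv_add_left, listConv_add_right, ← ih, ← ih, ← ih, add_assoc]

/-- The number of letters in a list of letters and bars. -/
def letterCount : List (Option A) → ℕ
  | [] => 0
  | none :: l => letterCount l
  | some _ :: l => letterCount l + 1

/-- The coproduct preserves the number of letters. -/
theorem listConv_eq_zero {F G : List (Option A) → k} {l : List (Option A)}
    (h : ∀ x y, letterCount x + letterCount y = letterCount l → F x * G y = 0) :
    listConv F G l = 0 := by
  induction l generalizing F G with
  | nil => exact h [] [] rfl
  | cons z l ih =>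
    cases z with
    | none => exact ih fun x y hxy => h _ _ hxy
    | some a =>
      have h1 := ih (F := fun x => F (some a :: x)) (G := fun y => G (none :: y))
        fun x y hxy => h _ _ (by simp only [letterCount]; omega)
      have h2 := ih (F := F) (G := fun y => G (some a :: y))
        fun x y hxy => h _ _ (by simp only [letterCount]; omega)
      rw [listConv, h1, h2, add_zero]

theorem letterCount_map_some (u : List A) : letterCount (u.map some) = u.length := by
  induction u with
  | nil => rfl
  | cons a u ih => simp [letterCount, ih]

theorem maskBars_cons_of_mem {n : ℕ} (a : Fin n → A) {T : Finset (Fin n)} {i : Fin n} (hi : i ∈ T)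
    (L : List (Fin n)) : maskBars a T (i :: L) = some (a i) :: maskBars a T L := by
  simp [maskBars, hi]

theorem maskBars_cons_of_notMem {n : ℕ} (a : Fin n → A) {T : Finset (Fin n)} {i : Fin n}
    (hi : i ∉ T) (L : List (Fin n)) : maskBars a T (i :: L) = none :: maskBars a T L := by
  simp [maskBars, hi]

theorem maskBars_congr {n : ℕ} (a : Fin n → A) {T T' : Finset (Fin n)} {L : List (Fin n)}
    (h : ∀ i ∈ L, i ∈ T ↔ i ∈ T') : maskBars a T L = maskBars a T' L := by
  refine List.map_congr_left fun i hi => ?_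
  simp [h i hi]

/-- The expansion of the product of the factors `a ⊗ | + 1 ⊗ a` over the letters at the positions in
`L`. -/
theorem listConv_map_append {n : ℕ} (a : Fin n → A) (L : List (Fin n)) (hL : L.Nodup)
    (F G : List (Option A) → k) (l : List (Option A)) :
    listConv F G (L.map (fun i => some (a i)) ++ l) =
      ∑ S ∈ L.toFinset.powerset,
        listConv (fun x => F ((L.filter (· ∈ S)).map (fun i => some (a i)) ++ x))
          (fun y => G (maskBars a Sᶜ L ++ y)) l := by
  induction L generalizing F G with
  | nil => simp [maskBars]
  | cons i L ih =>
    rw [List.nodup_cons] at hL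
    have hi : i ∉ L.toFinset := by simpa using hL.1
    rw [List.toFinset_cons, Finset.sum_powerset_insert hi, add_comm]
    simp only [List.map_cons, List.cons_append, listConv]
    rw [ih hL.2, ih hL.2]
    congr 1
    · refine Finset.sum_congr rfl fun S hS => ?_
      rw [Finset.mem_powerset] at hS
      have h1 : (i :: L).filter (· ∈ insert i S) = i :: L.filter (· ∈ S) := by
        rw [List.filter_cons_of_pos (by simp)]
        congr 1
        refine List.filter_congr fun j hj => ?_
        have : j ≠ i := by rintro rfl; exact hL.1 hj
        simp [this]
      have h2 : maskBars a (insert i S)ᶜ (i :: L) = none :: maskBars a Sᶜ L := by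
        rw [maskBars_cons_of_notMem a (by simp)]
        congr 1
        refine maskBars_congr a fun j hj => ?_
        have : j ≠ i := by rintro rfl; exact hL.1 hj
        simp [this]
      rw [h1, h2]
      rfl
    · refine Finset.sum_congr rfl fun S hS => ?_
      rw [Finset.mem_powerset] at hS
      have hiS : i ∉ S := fun h => hi (hS h)
      rw [List.filter_cons_of_neg (by simpa using hiS),
        maskBars_cons_of_mem a (by simpa using hiS)]
      rfl

end

section

variable {k A : Type*} [Field k] [Ring A] [Algebra k A]

theorem barred_eq_one {l : List (Option A)} (h : letterCount l = 0) : barred k l = 1 := by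
  induction l with
  | nil => rfl
  | cons z l ih =>
    cases z with
    | none => rw [barred_none_cons, ih h]
    | some a => simp [letterCount] at h

theorem coproduct_word {n : ℕ} (a : Fin n → A) :
    coproduct k A (word k n a) = ∑ S : Finset (Fin n), subword k a S ⊗ₜ[k] complementBar k a S := by
  cases n with
  | zero =>
    have h : (Finset.univ : Finset (Finset (Fin 0))) = {∅} := rfl
    have h1 : subword k a ∅ = 1 := rfl
    have h2 : complementBar k a ∅ = 1 := by rw [complementBar_eq]; rfl
    rw [h, Finset.sum_singleton, h1, h2]
    exact map_one _
  | succ n =>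
    have : word k (n + 1) a = TensorAlgebra.ι k (DirectSum.lof k ℕ (fun m : ℕ => ⨂[k]^(m + 1) A) n
        (PiTensorProduct.tprod k a)) := rfl
    rw [this, coproduct, TensorAlgebra.lift_ι_apply, DirectSum.toModule_lof,
      PiTensorProduct.lift.tprod, sum_apply]
    rfl

theorem conv_apply (f g : DoubleTensorAlgebra k A →ₗ[k] k) (x : DoubleTensorAlgebra k A) :
    conv f g x = LinearMap.mul' k k (TensorProduct.map f g (coproduct k A x)) := rfl

theorem conv_word_mul {n : ℕ} (f g : DoubleTensorAlgebra k A →ₗ[k] k) (a : Fin n → A)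
    (y : DoubleTensorAlgebra k A) :
    conv f g (word k n a * y) = ∑ S : Finset (Fin n),
      conv (f ∘ₗ LinearMap.mulLeft k (subword k a S))
        (g ∘ₗ LinearMap.mulLeft k (complementBar k a S)) y := by
  simp only [conv_apply]
  rw [map_mul, coproduct_word, Finset.sum_mul, map_sum, map_sum]
  refine Finset.sum_congr rfl fun S _ => ?_
  congr 1
  induction coproduct k A y with
  | zero => simp
  | add x y hx hy => rw [mul_add, map_add, map_add, hx, hy]
  | tmul x y => simp

theorem conv_word {n : ℕ} (f g : DoubleTensorAlgebra k A →ₗ[k] k) (a : Fin n → A) :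
    conv f g (word k n a) = ∑ S : Finset (Fin n), f (subword k a S) * g (complementBar k a S) := by
  simp [conv_apply, coproduct_word]

/-- The convolution of linear forms on `H` is the convolution of functions on lists. -/
theorem conv_barred (f g : DoubleTensorAlgebra k A →ₗ[k] k) (l : List (Option A)) :
    conv f g (barred k l) = listConv (fun x => f (barred k x)) (fun y => g (barred k y)) l := by
  suffices h : ∀ (u : List A) (f g : DoubleTensorAlgebra k A →ₗ[k] k),
      conv f g (barred k (u.map some ++ l)) =
        listConv (fun x => f (barred k x)) (fun y => g (barred k y)) (u.map some ++ l) from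
    h [] f g
  have hu : ∀ u : List A, u.map some = (List.finRange u.length).map fun i => some (u.get i) := by
    intro u
    conv_lhs => rw [← List.map_get_finRange u, List.map_map]
    rfl
  have hS : ∀ (u : List A) (S : Finset (Fin u.length)),
      barred k (((List.finRange u.length).filter (· ∈ S)).map fun i => some (u.get i)) =
        subword k u.get S := by
    intro u S
    rw [subword_eq, ← barred_map_some, List.map_map]
    rfl
  have hw : ∀ u : List A, word k u.length u.get = barred k (u.map some) := fun u =>
    (barred_map_some u).symm
  induction l with
  | nil =>
    intro u f g
    rw [List.append_nil, ← hw, conv_word]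
    conv_rhs => rw [hu, ← List.append_nil (List.map _ _)]
    rw [listConv_map_append _ _ (List.nodup_finRange _), List.toFinset_finRange,
      Finset.powerset_univ]
    refine Finset.sum_congr rfl fun S _ => ?_
    simp only [listConv, List.append_nil]
    rw [hS, complementBar_eq]
  | cons z l ih =>
    intro u f g
    cases z with
    | some a => simpa using ih (u ++ [a]) f g
    | none =>
      rw [barred_append_none, ← hw, conv_word_mul]
      conv_rhs => rw [hu]
      rw [listConv_map_append _ _ (List.nodup_finRange _), List.toFinset_finRange,
        Finset.powerset_univ]
      refine Finset.sum_congr rfl fun S _ => ?_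
      have h := ih [] (f ∘ₗ LinearMap.mulLeft k (subword k u.get S))
        (g ∘ₗ LinearMap.mulLeft k (complementBar k u.get S))
      simp only [List.map_nil, List.nil_append] at h
      rw [h]
      simp only [listConv, barred_append_none, hS, complementBar_eq]
      rfl

theorem conv_assoc (f g h : DoubleTensorAlgebra k A →ₗ[k] k) :
    conv (conv f g) h = conv f (conv g h) := by
  refine form_ext fun l => ?_
  rw [conv_barred, conv_barred]
  simp only [conv_barred]
  exact listConv_assoc _ _ _ l

end

/-! ### The convolution algebra -/

section

variable {k A : Type*} [Field k] [Ring A] [Algebra k A]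

theorem counit_listWord (u : List A) :
    counit k A (listWord k u) = if u.length = 0 then 1 else 0 := by
  cases u with
  | nil => exact map_one _
  | cons a u =>
    have h : listWord k (a :: u) = TensorAlgebra.ι k (DirectSum.lof k ℕ
      (fun m : ℕ => ⨂[k]^(m + 1) A) u.length (PiTensorProduct.tprod k (a :: u).get)) := rfl
    rw [h, counit, TensorAlgebra.algebraMapInv, TensorAlgebra.lift_ι_apply]
    simp

theorem counit_barred (l : List (Option A)) :
    counit k A (barred k l) = if letterCount l = 0 then 1 else 0 := by
  suffices h : ∀ u : List A, counit k A (readBars k u l) =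
      if u.length + letterCount l = 0 then 1 else 0 by simpa [barred] using h []
  induction l with
  | nil => intro u; simp [readBars, letterCount, counit_listWord]
  | cons z l ih =>
    intro u
    cases z with
    | none =>
      rw [readBars, map_mul, ih, counit_listWord]
      by_cases hu : u.length = 0 <;> simp [hu, letterCount]
    | some a => simp [readBars, ih, letterCount]

theorem listConv_counit_left (G : List (Option A) → k) (l : List (Option A)) :
    listConv (fun x => counit k A (barred k x)) G l = G l := by
  have h0 : ∀ G : List (Option A) → k, ∀ l, listConv (fun _ => 0) G l = 0 := fun G l =>
    listConv_eq_zero fun _ _ _ => zero_mul _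
  induction l generalizing G with
  | nil => simp [listConv, barred, readBars, listWord_nil]
  | cons z l ih =>
    cases z with
    | none => simpa only [listConv, barred_none_cons] using ih _
    | some a =>
      have h : ∀ x, counit k A (barred k (some a :: x)) = 0 := fun x => by
        simp [counit_barred, letterCount]
      simp only [listConv, ih, h, h0, zero_add]

theorem listConv_counit_right (F : List (Option A) → k) (l : List (Option A)) :
    listConv F (fun x => counit k A (barred k x)) l = F l := by
  have h0 : ∀ F : List (Option A) → k, ∀ l, listConv F (fun _ => 0) l = 0 := fun F l =>
    listConv_eq_zero fun _ _ _ => mul_zero _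
  induction l generalizing F with
  | nil => simp [listConv, barred, readBars, listWord_nil]
  | cons z l ih =>
    cases z with
    | none => simpa only [listConv, barred_none_cons] using ih _
    | some a =>
      have h : ∀ x, counit k A (barred k (some a :: x)) = 0 := fun x => by
        simp [counit_barred, letterCount]
      simp only [listConv, barred_none_cons, ih, h, h0, add_zero]

/-- The linear forms on `H` with the convolution product. -/
instance convRing : Ring (DoubleTensorAlgebra k A →ₗ[k] k) :=
  { (inferInstance : AddCommGroup (DoubleTensorAlgebra k A →ₗ[k] k)) with
    mul := conv
    one := (counit k A).toLinearMap
    mul_assoc := conv_assoc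
    one_mul := fun f => form_ext fun l =>
      (conv_barred _ f l).trans (listConv_counit_left (fun y => f (barred k y)) l)
    mul_one := fun f => form_ext fun l =>
      (conv_barred f _ l).trans (listConv_counit_right (fun y => f (barred k y)) l)
    zero_mul := fun f => form_ext fun l =>
      (conv_barred 0 f l).trans (listConv_eq_zero fun _ _ _ => zero_mul _)
    mul_zero := fun f => form_ext fun l =>
      (conv_barred f 0 l).trans (listConv_eq_zero fun _ _ _ => mul_zero _)
    left_distrib := fun f g h => form_ext fun l => by
      change conv f (g + h) (barred k l) = conv f g (barred k l) + conv f h (barred k l)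
      rw [conv_barred, conv_barred, conv_barred]
      exact listConv_add_right _ _ _ l
    right_distrib := fun f g h => form_ext fun l => by
      change conv (f + g) h (barred k l) = conv f h (barred k l) + conv g h (barred k l)
      rw [conv_barred, conv_barred, conv_barred]
      exact listConv_add_left _ _ _ l
    zsmul := fun n f => n • f
    nsmul := fun n f => n • f
    nsmul_zero := AddMonoid.nsmul_zero
    nsmul_succ := AddMonoid.nsmul_succ
    zsmul_zero' := SubNegMonoid.zsmul_zero'
    zsmul_succ' := SubNegMonoid.zsmul_succ'
    zsmul_neg' := SubNegMonoid.zsmul_neg' }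

theorem mul_eq_conv (f g : DoubleTensorAlgebra k A →ₗ[k] k) : f * g = conv f g := rfl

theorem one_eq_counit : (1 : DoubleTensorAlgebra k A →ₗ[k] k) = (counit k A).toLinearMap := rfl

instance : Algebra k (DoubleTensorAlgebra k A →ₗ[k] k) :=
  Algebra.ofModule
    (fun c f g => by
      ext1 x
      change _ = c • (f * g) x
      rw [mul_eq_conv, mul_eq_conv, conv_apply, conv_apply, TensorProduct.map_smul_left]
      simp)
    (fun c f g => by
      ext1 x
      change _ = c • (f * g) x
      rw [mul_eq_conv, mul_eq_conv, conv_apply, conv_apply, TensorProduct.map_smul_right]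
      simp)

theorem convPow_eq_pow (f : DoubleTensorAlgebra k A →ₗ[k] k) (n : ℕ) : convPow f n = f ^ n := by
  induction n with
  | zero => rw [pow_zero]; rfl
  | succ n ih => rw [pow_succ, ← ih]; rfl

/-- The form `f` vanishes on all elements of `H` with fewer than `n` letters. -/
def HasOrderGE (n : ℕ) (f : DoubleTensorAlgebra k A →ₗ[k] k) : Prop :=
  ∀ l, letterCount l < n → f (barred k l) = 0

theorem HasOrderGE.mul {m n : ℕ} {f g : DoubleTensorAlgebra k A →ₗ[k] k} (hf : HasOrderGE m f)
    (hg : HasOrderGE n g) : HasOrderGE (m + n) (f * g) := by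
  intro l hl
  rw [mul_eq_conv, conv_barred]
  refine listConv_eq_zero fun x y hxy => ?_
  by_cases hx : letterCount x < m
  · rw [hf x hx, zero_mul]
  · rw [hg y (by omega), mul_zero]

theorem hasOrderGE_zero (f : DoubleTensorAlgebra k A →ₗ[k] k) : HasOrderGE 0 f :=
  fun _ h => absurd h (Nat.not_lt_zero _)

theorem hasOrderGE_one {f : DoubleTensorAlgebra k A →ₗ[k] k} (hf : f 1 = 0) : HasOrderGE 1 f := by
  intro l hl
  rw [barred_eq_one (by omega), hf]

theorem hasOrderGE_pow {f : DoubleTensorAlgebra k A →ₗ[k] k} (hf : f 1 = 0) (n : ℕ) :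
    HasOrderGE n (f ^ n) := by
  induction n with
  | zero => exact hasOrderGE_zero _
  | succ n ih => rw [pow_succ]; exact ih.mul (hasOrderGE_one hf)

theorem mul_barred_congr {d : ℕ} {f f' g g' : DoubleTensorAlgebra k A →ₗ[k] k}
    (hf : HasOrderGE (d + 1) (f - f')) (hg : HasOrderGE (d + 1) (g - g')) {l : List (Option A)}
    (hl : letterCount l ≤ d) : (f * g) (barred k l) = (f' * g') (barred k l) := by
  have h1 := hf.mul (hasOrderGE_zero g) l (by omega)
  have h2 := (hasOrderGE_zero f').mul hg l (by omega)
  have h : f * g - f' * g' = (f - f') * g + f' * (g - g') := by noncomm_ring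
  rw [← sub_eq_zero, ← LinearMap.sub_apply, h, LinearMap.add_apply, h1, h2, add_zero]

theorem exists_pow_apply_eq_zero {f : DoubleTensorAlgebra k A →ₗ[k] k} (hf : f 1 = 0)
    (x : DoubleTensorAlgebra k A) : ∃ N, ∀ j, N ≤ j → (f ^ j) x = 0 := by
  have hx : x ∈ Submodule.span k (Set.range (barred k (A := A))) := by
    rw [span_range_barred]; trivial
  induction hx using Submodule.span_induction with
  | mem x h =>
    obtain ⟨l, rfl⟩ := h
    exact ⟨letterCount l + 1, fun j hj => hasOrderGE_pow hf j l (by omega)⟩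
  | zero => exact ⟨0, fun j _ => map_zero _⟩
  | add x y _ _ hx hy =>
    obtain ⟨M, hM⟩ := hx
    obtain ⟨N, hN⟩ := hy
    exact ⟨max M N, fun j hj => by
      rw [map_add, hM j (by omega), hN j (by omega), add_zero]⟩
  | smul c x _ hx =>
    obtain ⟨M, hM⟩ := hx
    exact ⟨M, fun j hj => by rw [map_smul, hM j hj, smul_zero]⟩

theorem pointwiseSum_apply {f : ℕ → DoubleTensorAlgebra k A →ₗ[k] k}
    (hf : ∀ x, ∃ N, ∀ j, N ≤ j → f j x = 0) {x : DoubleTensorAlgebra k A} {N : ℕ}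
    (hN : ∀ j, N ≤ j → f j x = 0) : pointwiseSum f x = ∑ j ∈ Finset.range N, f j x := by
  have hfin : ∀ x, (Function.support fun j => f j x).Finite := by
    intro x
    obtain ⟨N, hN⟩ := hf x
    refine (Finset.range N).finite_toSet.subset fun j hj => ?_
    rw [Finset.mem_coe, Finset.mem_range]
    by_contra h
    exact hj (hN j (not_lt.1 h))
  rw [pointwiseSum, dif_pos hfin]
  refine finsum_eq_finsetSum_of_support_subset _ fun j hj => ?_
  rw [Finset.mem_coe, Finset.mem_range]
  by_contra h
  exact hj (hN j (not_lt.1 h))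

/-! ### Power series in a form that vanishes at the unit -/

/-- The value of a power series at a linear form, for the convolution product. -/
def evalSeries (γ : DoubleTensorAlgebra k A →ₗ[k] k) (F : PowerSeries k) :
    DoubleTensorAlgebra k A →ₗ[k] k :=
  pointwiseSum fun j => PowerSeries.coeff j F • γ ^ j

variable {γ : DoubleTensorAlgebra k A →ₗ[k] k}

theorem evalSeries_apply (hγ : γ 1 = 0) (F : PowerSeries k) {x : DoubleTensorAlgebra k A} {N : ℕ}
    (hN : ∀ j, N ≤ j → (γ ^ j) x = 0) :
    evalSeries γ F x = ∑ j ∈ Finset.range N, PowerSeries.coeff j F * (γ ^ j) x := by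
  rw [evalSeries, pointwiseSum_apply (N := N)]
  · rfl
  · intro y
    obtain ⟨M, hM⟩ := exists_pow_apply_eq_zero hγ y
    exact ⟨M, fun j hj => by rw [LinearMap.smul_apply, hM j hj, smul_zero]⟩
  · exact fun j hj => by rw [LinearMap.smul_apply, hN j hj, smul_zero]

theorem evalSeries_barred (hγ : γ 1 = 0) (F : PowerSeries k) {l : List (Option A)} {d : ℕ}
    (hl : letterCount l ≤ d) : evalSeries γ F (barred k l) =
      ∑ j ∈ Finset.range (d + 1), PowerSeries.coeff j F * (γ ^ j) (barred k l) :=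
  evalSeries_apply hγ F fun j hj => hasOrderGE_pow hγ j l (by omega)

theorem evalSeries_sub_hasOrderGE (hγ : γ 1 = 0) (F : PowerSeries k) (d : ℕ) :
    HasOrderGE (d + 1)
      (evalSeries γ F - ∑ j ∈ Finset.range (d + 1), PowerSeries.coeff j F • γ ^ j) := by
  intro l hl
  rw [LinearMap.sub_apply, evalSeries_barred hγ F (Nat.lt_succ_iff.1 hl), LinearMap.sum_apply]
  exact sub_self _

/-- On elements with at most `d` letters, power series in `γ` can be truncated after degree `d`. -/
theorem evalSeries_mul (hγ : γ 1 = 0) (F G : PowerSeries k) :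
    evalSeries γ (F * G) = evalSeries γ F * evalSeries γ G := by
  refine form_ext fun l => ?_
  set d := letterCount l with hd
  have hz : ∀ j, d < j → (γ ^ j) (barred k l) = 0 := fun j hj =>
    hasOrderGE_pow hγ j l (hd ▸ hj)
  rw [mul_barred_congr (evalSeries_sub_hasOrderGE hγ F d) (evalSeries_sub_hasOrderGE hγ G d)
    hd.ge, evalSeries_barred hγ _ hd.ge, Finset.sum_mul_sum, LinearMap.sum_apply]
  simp only [PowerSeries.coeff_mul, Finset.sum_mul, LinearMap.sum_apply]
  have h1 : ∀ m, (∑ p ∈ Finset.HasAntidiagonal.antidiagonal m, PowerSeries.coeff p.1 F *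
      PowerSeries.coeff p.2 G * (γ ^ m) (barred k l)) = ∑ i ∈ Finset.range (m + 1), PowerSeries.coeff i F *
        PowerSeries.coeff (m - i) G * (γ ^ (i + (m - i))) (barred k l) := by
    intro m
    rw [Finset.Nat.sum_antidiagonal_eq_sum_range_succ_mk]
    refine Finset.sum_congr rfl fun i hi => ?_
    rw [Finset.mem_range] at hi
    simp only
    rw [show i + (m - i) = m by omega]
  simp only [h1]
  rw [Finset.sum_range_diag_flip (d + 1) fun i j => PowerSeries.coeff i F *
    PowerSeries.coeff j G * (γ ^ (i + j)) (barred k l)]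
  refine Finset.sum_congr rfl fun i hi => ?_
  rw [Finset.mem_range] at hi
  refine (Finset.sum_subset (Finset.range_subset_range.2 (Nat.sub_le _ _)) fun j _ hj => ?_).trans
    (Finset.sum_congr rfl fun j _ => ?_)
  · rw [Finset.mem_range] at hj
    rw [hz _ (by omega), mul_zero]
  · rw [smul_mul_smul_comm, ← pow_add]
    rfl

theorem evalSeries_one (hγ : γ 1 = 0) : evalSeries γ 1 = 1 := by
  refine form_ext fun l => ?_
  rw [evalSeries_barred hγ 1 le_rfl, Finset.sum_range_succ']
  simp [PowerSeries.coeff_one]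

theorem evalSeries_pow (hγ : γ 1 = 0) (F : PowerSeries k) (n : ℕ) :
    evalSeries γ (F ^ n) = evalSeries γ F ^ n := by
  induction n with
  | zero => rw [pow_zero, pow_zero, evalSeries_one hγ]
  | succ n ih => rw [pow_succ, pow_succ, evalSeries_mul hγ, ih]

theorem evalSeries_one_add_X (hγ : γ 1 = 0) : evalSeries γ (1 + PowerSeries.X) = 1 + γ := by
  refine form_ext fun l => ?_
  rw [evalSeries_barred hγ _ (Nat.le_succ _), Finset.sum_range_succ', Finset.sum_range_succ']
  simp [PowerSeries.coeff_one, PowerSeries.coeff_X, add_comm]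

theorem evalSeries_apply_one (hγ : γ 1 = 0) (F : PowerSeries k) :
    evalSeries γ F 1 = PowerSeries.constantCoeff F := by
  have h := evalSeries_barred hγ F (l := []) (d := 0) le_rfl
  have h1 : barred k ([] : List (Option A)) = 1 := rfl
  rw [h1] at h
  rw [h]
  simp [one_eq_counit]

theorem evalSeries_subst (hγ : γ 1 = 0) {F G : PowerSeries k}
    (hG : PowerSeries.constantCoeff G = 0) :
    evalSeries γ (F.subst G) = evalSeries (evalSeries γ G) F := by
  have hρ : evalSeries γ G 1 = 0 := by rw [evalSeries_apply_one hγ, hG]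
  refine form_ext fun l => ?_
  rw [evalSeries_barred hγ _ le_rfl, evalSeries_barred hρ _ le_rfl]
  simp only [← evalSeries_pow hγ, evalSeries_barred hγ _ (le_refl (letterCount l)), Finset.mul_sum]
  rw [Finset.sum_comm]
  refine Finset.sum_congr rfl fun i hi => ?_
  rw [Finset.mem_range] at hi
  have hz : ∀ j, i < j → PowerSeries.coeff i (G ^ j) = 0 := fun j hj =>
    PowerSeries.coeff_of_lt_order i (lt_of_lt_of_le (by exact_mod_cast hj)
      (PowerSeries.le_order_pow_of_constantCoeff_eq_zero j hG))
  rw [PowerSeries.coeff_subst' (PowerSeries.HasSubst.of_constantCoeff_zero' hG),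
    finsum_eq_finsetSum_of_support_subset (s := Finset.range (letterCount l + 1)), Finset.sum_mul]
  · exact Finset.sum_congr rfl fun j _ => by rw [smul_eq_mul, mul_assoc]
  · intro j hj
    rw [Finset.mem_coe, Finset.mem_range]
    by_contra h
    exact hj (by simp only; rw [hz j (by omega), smul_zero])

end

/-! ### Exponential and logarithm -/

theorem exp_subst_log (k : Type*) [Field k] [CharZero k] :
    (PowerSeries.exp k).subst (PowerSeries.log k) = 1 + PowerSeries.X := by
  set E := (PowerSeries.exp k).subst (PowerSeries.log k) with hE
  have hlog : (PowerSeries.derivative k (PowerSeries.log k)) * (1 + PowerSeries.X) = 1 := by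
    rw [PowerSeries.deriv_log, mul_add, mul_one]
    ext n
    cases n with
    | zero => simp
    | succ n => simp [PowerSeries.coeff_succ_mul_X, PowerSeries.coeff_one, pow_succ]
  have hd : PowerSeries.derivative k E * (1 + PowerSeries.X) = E := by
    rw [hE, PowerSeries.derivative_subst PowerSeries.HasSubst.log, PowerSeries.derivative_exp,
      mul_assoc, hlog, mul_one]
  have h0 : PowerSeries.coeff 0 E = 1 := by
    rw [hE, PowerSeries.coeff_subst' PowerSeries.HasSubst.log, finsum_eq_single _ 0]
    · simp
    · intro j hj
      simp [hj]
  -- The differential equation `(1 + X) E' = E` determines all coefficients from the first one.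
  have hrec : ∀ n, PowerSeries.coeff (n + 1) E * (n + 1) + PowerSeries.coeff n E * n =
      PowerSeries.coeff n E := by
    intro n
    have h := congrArg (PowerSeries.coeff n) hd
    rw [mul_add, mul_one, map_add, PowerSeries.coeff_derivative] at h
    cases n with
    | zero => simpa using h
    | succ n =>
      rw [PowerSeries.coeff_succ_mul_X, PowerSeries.coeff_derivative] at h
      exact_mod_cast h
  have h1 : PowerSeries.coeff 1 E = 1 := by simpa [h0] using hrec 0
  have h2 : ∀ n, PowerSeries.coeff (n + 2) E = 0 := by
    intro n
    induction n with
    | zero => simpa [h1, add_eq_left] using hrec 1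
    | succ n ih =>
      have h := hrec (n + 2)
      rw [ih, zero_mul, add_zero, mul_eq_zero] at h
      rcases h with h | h
      · exact h
      · exact absurd h (by exact_mod_cast Nat.succ_ne_zero (n + 2))
  ext n
  rcases n with _ | _ | n
  · simp [h0]
  · simp [h1, PowerSeries.coeff_one]
  · simp [h2, PowerSeries.coeff_one, PowerSeries.coeff_X]

section

variable {k A : Type*} [Field k] [Ring A] [Algebra k A]

theorem exists_algHom_eq_pow (ψ : DoubleTensorAlgebra k A →ₐ[k] k) (t : ℕ) :
    ∃ χ : DoubleTensorAlgebra k A →ₐ[k] k, χ.toLinearMap = ψ.toLinearMap ^ t := by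
  induction t with
  | zero => exact ⟨counit k A, by rw [pow_zero]; rfl⟩
  | succ t ih =>
    obtain ⟨χ, hχ⟩ := ih
    refine ⟨(Algebra.TensorProduct.lmul' k).comp
      ((Algebra.TensorProduct.map χ ψ).comp (coproduct k A)), ?_⟩
    rw [pow_succ, ← hχ]
    rfl

end

section

variable {k A : Type*} [Field k] [CharZero k] [Ring A] [Algebra k A]

theorem convExp_eq (α : DoubleTensorAlgebra k A →ₗ[k] k) :
    convExp α = evalSeries α (PowerSeries.exp k) := by
  simp only [convExp, evalSeries, convPow_eq_pow, PowerSeries.coeff_exp]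
  congr 1
  funext j
  simp

theorem convLog_eq {f : DoubleTensorAlgebra k A →ₗ[k] k} (hf : f 1 = 1) :
    convLog f = evalSeries (f - 1) (PowerSeries.log k) := by
  have hγ : (f - 1) 1 = 0 := by simp [one_eq_counit, hf]
  refine form_ext fun l => ?_
  have hz : ∀ x, ∃ N : ℕ, ∀ j : ℕ, N ≤ j → (((-1 : k) ^ j / ((j : k) + 1)) •
      convPow (f - (counit k A).toLinearMap) (j + 1)) x = 0 := by
    intro x
    obtain ⟨N, hN⟩ := exists_pow_apply_eq_zero hγ x
    refine ⟨N, fun j hj => ?_⟩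
    rw [convPow_eq_pow, ← one_eq_counit, LinearMap.smul_apply, hN _ (by omega), smul_zero]
  rw [convLog, pointwiseSum_apply hz (N := letterCount l), evalSeries_barred hγ _ le_rfl,
    Finset.sum_range_succ']
  · simp only [convPow_eq_pow, ← one_eq_counit, PowerSeries.coeff_log]
    simp only [Nat.succ_ne_zero, if_false, if_true, zero_mul, add_zero]
    refine Finset.sum_congr rfl fun j _ => ?_
    rw [LinearMap.smul_apply, smul_eq_mul]
    congr 1
    simp [pow_succ]
  · intro j hj
    rw [convPow_eq_pow, ← one_eq_counit, LinearMap.smul_apply,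
      hasOrderGE_pow hγ (j + 1) l (by omega), smul_zero]

theorem convLog_apply_one {f : DoubleTensorAlgebra k A →ₗ[k] k} (hf : f 1 = 1) :
    convLog f 1 = 0 := by
  rw [convLog_eq hf, evalSeries_apply_one (by simp [one_eq_counit, hf]),
    PowerSeries.constantCoeff_log]

theorem convExp_convLog {f : DoubleTensorAlgebra k A →ₗ[k] k} (hf : f 1 = 1) :
    convExp (convLog f) = f := by
  have hγ : (f - 1) 1 = 0 := by simp [one_eq_counit, hf]
  rw [convExp_eq, convLog_eq hf, ← evalSeries_subst hγ PowerSeries.constantCoeff_log,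
    exp_subst_log, evalSeries_one_add_X hγ, add_sub_cancel]

/-- At each element of `H` the powers of `exp^* α` are the values of a polynomial with linear
coefficient `α`. -/
theorem exists_polynomial_convExp_pow {α : DoubleTensorAlgebra k A →ₗ[k] k} (hα : α 1 = 0)
    (x : DoubleTensorAlgebra k A) : ∃ p : Polynomial k, p.coeff 0 = counit k A x ∧
      p.coeff 1 = α x ∧ ∀ t : ℕ, p.eval (t : k) = (convExp α ^ t) x := by
  obtain ⟨N, hN⟩ := exists_pow_apply_eq_zero hα x
  refine ⟨∑ j ∈ Finset.range (N + 2),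
    Polynomial.monomial j (PowerSeries.coeff j (PowerSeries.exp k) * (α ^ j) x), ?_, ?_, ?_⟩
  · rw [Polynomial.finsetSum_coeff, Finset.sum_eq_single 0]
    · simp [one_eq_counit]
    · intro j _ hj
      rw [Polynomial.coeff_monomial, if_neg hj]
    · intro h
      simp at h
  · rw [Polynomial.finsetSum_coeff, Finset.sum_eq_single 1]
    · simp
    · intro j _ hj
      rw [Polynomial.coeff_monomial, if_neg hj]
    · intro h
      simp at h
  · intro t
    rw [convExp_eq, ← evalSeries_pow hα, PowerSeries.exp_pow_eq_rescale_exp,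
      evalSeries_apply hα _ (N := N + 2) fun j hj => hN j (by omega), Polynomial.eval_finsetSum]
    refine Finset.sum_congr rfl fun j _ => ?_
    rw [Polynomial.eval_monomial, PowerSeries.coeff_rescale]
    ring

theorem polynomial_eq_of_eval_natCast_eq {p q : Polynomial k}
    (h : ∀ t : ℕ, p.eval (t : k) = q.eval (t : k)) : p = q :=
  Polynomial.eq_of_infinite_eval_eq p q
    ((Set.infinite_range_of_injective Nat.cast_injective).mono
      (by rintro _ ⟨t, rfl⟩; exact h t))

/-- The form `α` is determined by the natural powers of `exp^* α`, as a polynomial is determined by its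
values at the natural numbers. -/
theorem convExp_injective {α β : DoubleTensorAlgebra k A →ₗ[k] k} (hα : α 1 = 0) (hβ : β 1 = 0)
    (h : convExp α = convExp β) : α = β := by
  ext1 x
  obtain ⟨p, -, hp1, hp⟩ := exists_polynomial_convExp_pow hα x
  obtain ⟨q, -, hq1, hq⟩ := exists_polynomial_convExp_pow hβ x
  have hpq : p = q := polynomial_eq_of_eval_natCast_eq fun t => by rw [hp, hq, h]
  rw [← hp1, ← hq1, hpq]

/-- The logarithm of a character is an infinitesimal character: its value at `x` is the derivative
at `t = 0` of the polynomial with values `f^{* t}(x)`, and these polynomials are multiplicative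
in `x`. -/
theorem isInfinitesimalCharacter_convLog (ψ : DoubleTensorAlgebra k A →ₐ[k] k) :
    IsInfinitesimalCharacter (convLog ψ.toLinearMap) := by
  have h1 : ψ.toLinearMap 1 = 1 := map_one ψ
  have h0 := convLog_apply_one h1
  refine ⟨h0, fun x y hx hy => ?_⟩
  obtain ⟨p, hp0, hp1, hp⟩ := exists_polynomial_convExp_pow h0 x
  obtain ⟨q, hq0, hq1, hq⟩ := exists_polynomial_convExp_pow h0 y
  obtain ⟨r, hr0, hr1, hr⟩ := exists_polynomial_convExp_pow h0 (x * y)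
  rw [convExp_convLog h1] at hp hq hr
  have h : r = p * q := polynomial_eq_of_eval_natCast_eq fun t => by
    obtain ⟨χ, hχ⟩ := exists_algHom_eq_pow ψ t
    rw [Polynomial.eval_mul, hp, hq, hr, ← hχ]
    exact map_mul χ x y
  rw [← hr1, h, Polynomial.mul_coeff_one, hp0, hq0, hx, hy, zero_mul, mul_zero, add_zero]

end

/-! ### Convolution with an infinitesimal character -/

section

/-- The set `V` contains all elements of `T` between two elements of `V`. -/
def IsConvexIn {n : ℕ} (T V : Finset (Fin n)) : Prop :=
  ∀ a ∈ V, ∀ b ∈ V, ∀ c ∈ T, a ≤ c → c ≤ b → c ∈ V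

theorem filter_mem_map_orderEmb {m n : ℕ} (e : Fin m ↪o Fin n) (V : Finset (Fin m)) :
    (List.finRange n).filter (· ∈ V.map e.toEmbedding) =
      ((List.finRange m).filter (· ∈ V)).map e := by
  refine List.Perm.eq_of_pairwise (le := (· < ·)) ?_
    ((List.sortedLT_finRange n).pairwise.filter _) ?_ ?_
  · exact fun a b _ _ h1 h2 => absurd h2 h1.asymm
  · rw [List.pairwise_map]
    exact ((List.sortedLT_finRange m).pairwise.imp fun h => e.lt_iff_lt.2 h).filter _
  · rw [List.perm_ext_iff_of_nodup ((List.nodup_finRange n).filter _)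
      (((List.nodup_finRange m).filter _).map e.injective)]
    simp

variable {k A : Type*} [Field k] [Ring A] [Algebra k A]

theorem subword_letters {n : ℕ} (a : Fin n → A) (T : Finset (Fin n)) (V : Finset (Fin T.card)) :
    subword k (letters a T) V = subword k a (V.map (T.orderEmbOfFin rfl).toEmbedding) := by
  rw [subword_eq, subword_eq, filter_mem_map_orderEmb, List.map_map]
  rfl

theorem word_eq_subword_univ {n : ℕ} (a : Fin n → A) :
    word k n a = subword k a Finset.univ := by
  rw [subword_eq, word_eq_listWord, List.ofFn_eq_map]
  simp

theorem counit_subword {n : ℕ} (a : Fin n → A) (S : Finset (Fin n)) :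
    counit k A (subword k a S) = if S = ∅ then 1 else 0 := by
  rw [subword, word_eq_listWord, counit_listWord, List.length_ofFn]
  simp

theorem run_nonempty {n : ℕ} {T : Finset (Fin n)} {s : Fin n} (hs : s ∈ starts T) :
    (run T s).Nonempty := by
  have hsT := (Finset.mem_filter.1 hs).1
  exact ⟨s, by simp [run, hsT]⟩

/-- An infinitesimal character only sees the complements which consist of a single interval. -/
theorem IsInfinitesimalCharacter.apply_complementBar {α : DoubleTensorAlgebra k A →ₗ[k] k}
    (hα : IsInfinitesimalCharacter α) {n : ℕ} (a : Fin n → A) (V : Finset (Fin n))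
    [Decidable (V.Nonempty ∧ IsConvexIn Finset.univ V)] :
    α (complementBar k a Vᶜ) =
      if V.Nonempty ∧ IsConvexIn Finset.univ V then α (subword k a V) else 0 := by
  rw [complementBar, compl_compl]
  have hmem := fun i (hi : i ∈ V) => exists_mem_components hi
  have hsub := fun J (hJ : J ∈ components V) => components_subset hJ
  have hst : ∀ s ∈ (starts V).sort (· ≤ ·), s ∈ starts V := fun s hs => (Finset.mem_sort _).1 hs
  have hsorted := (starts V).sortedLT_sort.pairwise
  rw [components] at hmem hsub ⊢
  generalize (starts V).sort (· ≤ ·) = L at hmem hsub hst hsorted ⊢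
  match L with
  | [] =>
    rw [if_neg]
    · simpa using hα.1
    · rintro ⟨⟨i, hi⟩, -⟩
      simpa using hmem i hi
  | [s] =>
    have hV : run V s = V := by
      refine Finset.Subset.antisymm (hsub _ (by simp)) fun i hi => ?_
      simpa using hmem i hi
    rw [if_pos]
    · simp [hV]
    · refine ⟨hV ▸ run_nonempty (hst s (by simp)), fun i hi j hj c _ h1 h2 => ?_⟩
      rw [← hV, run, Finset.mem_filter] at hi hj
      exact hj.2.2 (Finset.mem_Icc.2 ⟨hi.2.1.trans h1, h2⟩)
  | s :: t :: L =>
    have hlt : s < t := (List.pairwise_cons.1 hsorted).1 t (by simp)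
    have hs := hst s (by simp)
    have ht := hst t (by simp)
    rw [if_neg]
    · simp only [List.map_cons, List.prod_cons]
      refine hα.2 _ _ ?_ ?_
      · rw [counit_subword, if_neg (run_nonempty hs).ne_empty]
      · rw [map_mul, counit_subword, if_neg (run_nonempty ht).ne_empty, zero_mul]
    · rintro ⟨-, h⟩
      have ht' := Finset.mem_filter.1 ht
      rw [Fin.lt_def] at hlt
      have hlt' : (t : ℕ) - 1 < n := by omega
      refine ht'.2 ⟨t - 1, hlt'⟩ (h s (Finset.mem_filter.1 hs).1 t ht'.1 _ (Finset.mem_univ _) ?_ ?_)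
        ?_
      · rw [Fin.le_def]; simp only; omega
      · rw [Fin.le_def]; simp only; omega
      · simp only; omega

open Classical in
/-- Convolution with an infinitesimal character removes an interval from a word. -/
theorem conv_subword {α : DoubleTensorAlgebra k A →ₗ[k] k} (hα : IsInfinitesimalCharacter α)
    (f : DoubleTensorAlgebra k A →ₗ[k] k) {n : ℕ} (a : Fin n → A) (T : Finset (Fin n)) :
    conv f α (subword k a T) = ∑ V : Finset (Fin n) with V ⊆ T ∧ V.Nonempty ∧ IsConvexIn T V,
      f (subword k a (T \ V)) * α (subword k a V) := by
  set e := (T.orderEmbOfFin rfl) with he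
  have hT : Finset.univ.map e.toEmbedding = T := T.map_orderEmbOfFin_univ rfl
  have hmemT : ∀ i, e i ∈ T := fun i => T.orderEmbOfFin_mem rfl i
  rw [subword, conv_word]
  rw [← Equiv.sum_comp (Function.Involutive.toPerm compl compl_involutive)]
  simp only [Function.Involutive.coe_toPerm, hα.apply_complementBar, mul_ite, mul_zero]
  rw [← Finset.sum_filter]
  refine Finset.sum_bij (fun V _ => V.map e.toEmbedding) ?_ ?_ ?_ ?_
  · intro V hV
    simp only [Finset.mem_filter, Finset.mem_univ, true_and] at hV ⊢
    refine ⟨?_, by simpa using hV.1, ?_⟩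
    · conv_rhs => rw [← hT]
      exact Finset.map_subset_map.2 (Finset.subset_univ _)
    · intro x hx y hy z hz hxz hzy
      rw [← hT] at hz
      simp only [Finset.mem_map, Finset.mem_univ, true_and] at hx hy hz
      obtain ⟨x, hx, rfl⟩ := hx
      obtain ⟨y, hy, rfl⟩ := hy
      obtain ⟨z, rfl⟩ := hz
      exact Finset.mem_map_of_mem _ (hV.2 x hx y hy z (Finset.mem_univ _)
        (e.le_iff_le.1 hxz) (e.le_iff_le.1 hzy))
  · intro V _ V' _ h
    exact Finset.map_injective _ h
  · intro V hV
    simp only [Finset.mem_filter, Finset.mem_univ, true_and] at hV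
    obtain ⟨hVT, hne, hc⟩ := hV
    rw [← hT, Finset.subset_map_iff] at hVT
    obtain ⟨U, -, rfl⟩ := hVT
    refine ⟨U, ?_, rfl⟩
    simp only [Finset.mem_filter, Finset.mem_univ, true_and]
    refine ⟨by simpa using hne, fun x hx y hy z _ hxz hzy => ?_⟩
    have := hc _ (Finset.mem_map_of_mem _ hx) _ (Finset.mem_map_of_mem _ hy) (e z) (hmemT z)
      (e.le_iff_le.2 hxz) (e.le_iff_le.2 hzy)
    simpa using this
  · intro V _
    rw [subword_letters, subword_letters, ← he]
    congr 3
    rw [Finset.compl_eq_univ_sdiff, Finset.map_sdiff, hT]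

/-! ### Monotone sequences of blocks -/

/-- `B` lists the blocks of a partition of `T` in the order of a monotone labelling. -/
def IsMonotoneSeq {n s : ℕ} (T : Finset (Fin n)) (B : Fin s → Finset (Fin n)) : Prop :=
  (∀ i, (B i).Nonempty) ∧ (∀ i j, i ≠ j → Disjoint (B i) (B j)) ∧
    (∀ x, x ∈ T ↔ ∃ i, x ∈ B i) ∧ ∀ i j, NestedLE (B i) (B j) → i ≤ j

/-- The last block of a monotone sequence is an interval, as no block is nested in it. -/
theorem isMonotoneSeq_snoc {n s : ℕ} (T V : Finset (Fin n)) (B : Fin s → Finset (Fin n)) :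
    IsMonotoneSeq T (Fin.snoc B V : Fin (s + 1) → Finset (Fin n)) ↔
      (V ⊆ T ∧ V.Nonempty ∧ IsConvexIn T V) ∧ IsMonotoneSeq (T \ V) B := by
  constructor
  · rintro ⟨h1, h2, h3, h4⟩
    have hdisj : ∀ i, Disjoint (B i) V := fun i => by
      simpa using h2 i.castSucc (Fin.last s) (Fin.castSucc_lt_last i).ne
    refine ⟨⟨fun x hx => (h3 x).2 ⟨Fin.last s, by simpa using hx⟩, by simpa using h1 (Fin.last s),
      ?_⟩, fun i => by simpa using h1 i.castSucc, fun i j hij => ?_, fun x => ?_, fun i j hij => ?_⟩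
    · intro a ha b hb c hc hac hcb
      obtain ⟨i, hi⟩ := (h3 c).1 hc
      induction i using Fin.lastCases with
      | last => simpa using hi
      | cast i =>
        have := h4 (Fin.last s) i.castSucc ⟨a, by simpa using ha, b, by simpa using hb, c, hi,
          hac, hcb⟩
        exact absurd this (not_le.2 (Fin.castSucc_lt_last i))
    · simpa using h2 i.castSucc j.castSucc (fun h => hij (Fin.castSucc_injective _ h))
    · rw [Finset.mem_sdiff, h3]
      constructor
      · rintro ⟨⟨i, hi⟩, hx⟩
        induction i using Fin.lastCases with
        | last => exact absurd (by simpa using hi) hx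
        | cast i => exact ⟨i, by simpa using hi⟩
      · rintro ⟨i, hi⟩
        exact ⟨⟨i.castSucc, by simpa using hi⟩, Finset.disjoint_left.1 (hdisj i) hi⟩
    · have := h4 i.castSucc j.castSucc (by simpa using hij)
      simpa using this
  · rintro ⟨⟨hVT, hVn, hVc⟩, h1, h2, h3, h4⟩
    have hdisj : ∀ i, Disjoint (B i) V := fun i =>
      Finset.disjoint_left.2 fun x hx => (Finset.mem_sdiff.1 ((h3 x).2 ⟨i, hx⟩)).2
    refine ⟨fun i => ?_, fun i j hij => ?_, fun x => ?_, fun i j hij => ?_⟩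
    · induction i using Fin.lastCases with
      | last => simpa using hVn
      | cast i => simpa using h1 i
    · induction i using Fin.lastCases with
      | last =>
        induction j using Fin.lastCases with
        | last => exact absurd rfl hij
        | cast j => simpa using (hdisj j).symm
      | cast i =>
        induction j using Fin.lastCases with
        | last => simpa using hdisj i
        | cast j => simpa using h2 i j (fun h => hij (congrArg _ h))
    · constructor
      · intro hx
        by_cases hxV : x ∈ V
        · exact ⟨Fin.last s, by simpa using hxV⟩
        · obtain ⟨i, hi⟩ := (h3 x).1 (Finset.mem_sdiff.2 ⟨hx, hxV⟩)
          exact ⟨i.castSucc, by simpa using hi⟩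
      · rintro ⟨i, hi⟩
        induction i using Fin.lastCases with
        | last => exact hVT (by simpa using hi)
        | cast i => exact (Finset.mem_sdiff.1 ((h3 x).2 ⟨i, by simpa using hi⟩)).1
    · induction j using Fin.lastCases with
      | last => exact Fin.le_last i
      | cast j =>
        induction i using Fin.lastCases with
        | last =>
          obtain ⟨a, ha, b, hb, c, hc, hac, hcb⟩ := hij
          simp only [Fin.snoc_last, Fin.snoc_castSucc] at ha hb hc
          have hcT := Finset.mem_sdiff.1 ((h3 c).2 ⟨j, hc⟩)
          exact absurd (hVc a ha b hb c hcT.1 hac hcb) hcT.2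
        | cast i => simpa using h4 i j (by simpa using hij)

open Classical in
/-- The last factor of `α^{* s}` removes the block with the largest label. -/
theorem pow_subword {α : DoubleTensorAlgebra k A →ₗ[k] k} (hα : IsInfinitesimalCharacter α)
    {n : ℕ} (a : Fin n → A) (s : ℕ) (T : Finset (Fin n)) :
    (α ^ s) (subword k a T) = ∑ B : Fin s → Finset (Fin n) with IsMonotoneSeq T B,
      ∏ i, α (subword k a (B i)) := by
  induction s generalizing T with
  | zero =>
    rw [pow_zero, one_eq_counit, AlgHom.toLinearMap_apply, counit_subword, Finset.sum_filter,
      Fintype.sum_unique, Finset.univ_eq_empty, Finset.prod_empty]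
    have h : ∀ B : Fin 0 → Finset (Fin n), IsMonotoneSeq T B ↔ T = ∅ := fun B => by
      simp [IsMonotoneSeq, Finset.eq_empty_iff_forall_notMem]
    exact (if_congr (h _) rfl rfl).symm
  | succ s ih =>
    rw [pow_succ, mul_eq_conv, conv_subword hα, Finset.sum_filter, Finset.sum_filter,
      ← Equiv.sum_comp (Fin.snocEquiv fun _ : Fin (s + 1) => Finset (Fin n)),
      Fintype.sum_prod_type]
    refine Finset.sum_congr rfl fun V _ => ?_
    have h : ∀ B : Fin s → Finset (Fin n),
        Fin.snocEquiv (fun _ : Fin (s + 1) => Finset (Fin n)) (V, B) = Fin.snoc B V := fun _ => rfl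
    simp only [h, isMonotoneSeq_snoc, Fin.prod_univ_castSucc, Fin.snoc_castSucc, Fin.snoc_last]
    by_cases hV : V ⊆ T ∧ V.Nonempty ∧ IsConvexIn T V
    · simp only [hV, true_and, and_self, if_true]
      rw [ih, Finset.sum_filter, Finset.sum_mul]
      exact Finset.sum_congr rfl fun B _ => by rw [ite_mul, zero_mul]
    · simp only [hV, false_and, if_false, Finset.sum_const_zero]

end

/-! ### Monotone labellings -/

section

theorem IsMonotoneSeq.injective {n s : ℕ} {T : Finset (Fin n)} {B : Fin s → Finset (Fin n)}
    (h : IsMonotoneSeq T B) : Function.Injective B := by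
  intro i j hij
  by_contra hne
  have := h.2.1 i j hne
  rw [hij, disjoint_self, Finset.bot_eq_empty] at this
  exact (h.1 j).ne_empty this

open Classical in
/-- The partition of `[n]` into the blocks of a monotone sequence. -/
def IsMonotoneSeq.partition {n s : ℕ} {B : Fin s → Finset (Fin n)}
    (h : IsMonotoneSeq Finset.univ B) : SetPartition n where
  parts := Finset.univ.image B
  supIndep := by
    rw [Finset.supIndep_iff_pairwiseDisjoint]
    intro P hP Q hQ hPQ
    simp only [Finset.coe_image, Finset.coe_univ, Set.image_univ, Set.mem_range] at hP hQ
    obtain ⟨i, rfl⟩ := hP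
    obtain ⟨j, rfl⟩ := hQ
    exact h.2.1 i j fun hij => hPQ (by rw [hij])
  sup_parts := by
    ext x
    rw [Finset.mem_sup]
    simpa using h.2.2.1 x
  bot_notMem := by
    intro hb
    obtain ⟨i, -, hi⟩ := Finset.mem_image.1 hb
    exact (h.1 i).ne_empty hi

/-- Two crossing blocks would be nested in each other, and so have the same label. -/
theorem IsMonotoneSeq.partition_isNonCrossing {n s : ℕ} {B : Fin s → Finset (Fin n)}
    (h : IsMonotoneSeq Finset.univ B) : IsNonCrossing h.partition := by
  classical
  rintro P hP Q hQ hPQ ⟨i, hi, l, hl, j, hj, m, hm, hij, hjl, hlm⟩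
  obtain ⟨p, -, rfl⟩ := Finset.mem_image.1 hP
  obtain ⟨q, -, rfl⟩ := Finset.mem_image.1 hQ
  have h1 := h.2.2.2 p q ⟨i, hi, l, hl, j, hj, hij.le, hjl.le⟩
  have h2 := h.2.2.2 q p ⟨j, hj, m, hm, l, hl, hjl.le, hlm.le⟩
  exact hPQ (by rw [le_antisymm h1 h2])

theorem IsMonotoneSeq.card_partition {n s : ℕ} {B : Fin s → Finset (Fin n)}
    (h : IsMonotoneSeq Finset.univ B) : h.partition.parts.card = s := by
  classical
  change (Finset.univ.image B).card = s
  rw [Finset.card_image_of_injective _ h.injective, Finset.card_univ, Fintype.card_fin]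

open Classical in
theorem card_isMonotoneSeq_eq {n : ℕ} (γ : SetPartition n) :
    (Finset.univ.filter fun B : Fin γ.parts.card → Finset (Fin n) =>
      IsMonotoneSeq Finset.univ B ∧ Finset.univ.image B = γ.parts).card =
      monotoneLabellingCount γ := by
  rw [monotoneLabellingCount, ← Fintype.card_coe]
  symm
  have hF : ∀ e : MonotoneLabelling γ, (fun i => ((e.1.symm i).1 : Finset (Fin n))) ∈
      (Finset.univ.filter fun B : Fin γ.parts.card → Finset (Fin n) =>
        IsMonotoneSeq Finset.univ B ∧ Finset.univ.image B = γ.parts) := by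
    rintro ⟨e, he⟩
    simp only [Finset.mem_filter, Finset.mem_univ, true_and]
    refine ⟨⟨fun i => γ.nonempty_of_mem_parts (e.symm i).2, fun i j hij => ?_, fun x => ?_,
      fun i j hij => by simpa using he _ _ hij⟩, ?_⟩
    · refine γ.disjoint (e.symm i).2 (e.symm j).2 fun h => hij ?_
      exact e.symm.injective (Subtype.ext h)
    · obtain ⟨P, hP, hx⟩ := γ.exists_mem (Finset.mem_univ x)
      simp only [Finset.mem_univ, true_iff]
      exact ⟨e ⟨P, hP⟩, by simpa using hx⟩
    · ext P
      simp only [Finset.mem_image, Finset.mem_univ, true_and]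
      constructor
      · rintro ⟨i, rfl⟩
        exact (e.symm i).2
      · exact fun hP => ⟨e ⟨P, hP⟩, by simp⟩
  refine Fintype.card_of_bijective (f := fun e => ⟨_, hF e⟩) ⟨?_, ?_⟩
  · rintro ⟨e, he⟩ ⟨e', he'⟩ h
    have h1 := congrFun (congrArg Subtype.val h)
    have h2 : e.symm = e'.symm := Equiv.ext fun i => Subtype.ext (h1 i)
    have h3 : e = e' := by rw [← e.symm_symm, h2, e'.symm_symm]
    exact Subtype.ext h3
  · rintro ⟨B, hB⟩
    obtain ⟨hB, himage⟩ := (Finset.mem_filter.1 hB).2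
    have hmem : ∀ i, B i ∈ γ.parts := fun i => by
      rw [← himage]
      exact Finset.mem_image_of_mem _ (Finset.mem_univ i)
    let f : Fin γ.parts.card → {P // P ∈ γ.parts} := fun i => ⟨B i, hmem i⟩
    have hf : Function.Bijective f := by
      refine ⟨fun i j hij => hB.injective (congrArg Subtype.val hij), ?_⟩
      rintro ⟨P, hP⟩
      rw [← himage] at hP
      obtain ⟨i, -, hi⟩ := Finset.mem_image.1 hP
      exact ⟨i, Subtype.ext hi⟩
    let e := Equiv.ofBijective f hf
    refine ⟨⟨e.symm, fun P Q hPQ => hB.2.2.2 _ _ ?_⟩, Subtype.ext (funext fun i => ?_)⟩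
    · have h : ∀ P, B (e.symm P) = P.1 := fun P => congrArg Subtype.val (e.apply_symm_apply P)
      rwa [h, h]
    · rfl

variable {k A : Type*} [Field k] [Ring A] [Algebra k A]

theorem pow_word {α : DoubleTensorAlgebra k A →ₗ[k] k} (hα : IsInfinitesimalCharacter α)
    {n : ℕ} (a : Fin n → A) (s : ℕ) :
    (α ^ s) (word k n a) = ∑ γ ∈ nonCrossingPartitions n with γ.parts.card = s,
      (monotoneLabellingCount γ : k) * blockProduct (formsOf α) γ a := by
  classical
  rw [word_eq_subword_univ, pow_subword hα]
  have h1 : ∀ γ : SetPartition n, γ.parts.card = s →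
      (monotoneLabellingCount γ : k) * blockProduct (formsOf α) γ a =
        ∑ B : Fin s → Finset (Fin n) with IsMonotoneSeq Finset.univ B,
          if Finset.univ.image B = γ.parts then ∏ i, α (subword k a (B i)) else 0 := by
    rintro γ rfl
    rw [← Finset.sum_filter, Finset.filter_filter, ← card_isMonotoneSeq_eq, ← nsmul_eq_mul]
    symm
    refine Finset.sum_eq_card_nsmul fun B hB => ?_
    obtain ⟨hB, himage⟩ := (Finset.mem_filter.1 hB).2
    refine Eq.trans ?_ (Finset.prod_congr himage fun _ _ => rfl)
    rw [Finset.prod_image fun i _ j _ h => hB.injective h]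
    rfl
  have h2 : ∀ γ ∈ (nonCrossingPartitions n).filter (fun γ => γ.parts.card = s),
      (monotoneLabellingCount γ : k) * blockProduct (formsOf α) γ a =
        ∑ B : Fin s → Finset (Fin n) with IsMonotoneSeq Finset.univ B,
          if Finset.univ.image B = γ.parts then ∏ i, α (subword k a (B i)) else 0 :=
    fun γ hγ => h1 γ (Finset.mem_filter.1 hγ).2
  rw [Finset.sum_congr rfl h2, Finset.sum_comm]
  refine Finset.sum_congr rfl fun B hB => ?_
  have hB := (Finset.mem_filter.1 hB).2
  have hparts : Finset.univ.image B = hB.partition.parts := rfl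
  rw [Finset.sum_eq_single hB.partition]
  · rw [if_pos hparts]
  · intro γ _ hne
    rw [if_neg]
    intro h
    exact hne (Finpartition.ext (h.symm.trans hparts))
  · intro h
    refine absurd ?_ h
    rw [Finset.mem_filter, nonCrossingPartitions, Finset.mem_filter]
    exact ⟨⟨Finset.mem_univ _, hB.partition_isNonCrossing⟩, hB.card_partition⟩

theorem convExp_word [CharZero k] {α : DoubleTensorAlgebra k A →ₗ[k] k}
    (hα : IsInfinitesimalCharacter α) {n : ℕ} (hn : 1 ≤ n) (a : Fin n → A) :
    convExp α (word k n a) = ∑ s ∈ Finset.Icc 1 n, ((s.factorial : k)⁻¹) *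
      ∑ γ ∈ nonCrossingPartitions n with γ.parts.card = s,
        (monotoneLabellingCount γ : k) * blockProduct (formsOf α) γ a := by
  have h0 : ((α ^ 0) (word k n a) : k) = 0 := by
    rw [pow_zero, one_eq_counit, AlgHom.toLinearMap_apply, word_eq_listWord, counit_listWord,
      List.length_ofFn, if_neg (by omega)]
  rw [convExp_eq, word_eq_listWord, ← barred_map_some,
    evalSeries_barred hα.1 _ (d := n) (by rw [letterCount_map_some, List.length_ofFn]), barred_map_some,
    ← word_eq_listWord,
    Finset.sum_range_succ', h0, mul_zero, add_zero]
  refine Finset.sum_bij (fun j _ => j + 1) (fun j hj => ?_) (fun i _ j _ h => Nat.succ_injective h)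
    (fun s hs => ?_) fun j _ => ?_
  · rw [Finset.mem_range] at hj
    exact Finset.mem_Icc.2 ⟨by omega, hj⟩
  · rw [Finset.mem_Icc] at hs
    exact ⟨s - 1, Finset.mem_range.2 (by omega), by omega⟩
  · rw [pow_word hα]
    simp [PowerSeries.coeff_exp]

end

/-! ### The hook length formula for forests -/

section

/-- The linear extensions of a partial order, as numberings of its elements. -/
abbrev LinearExtension (ι : Type*) [PartialOrder ι] (n : ℕ) : Type _ :=
  { e : ι ≃ Fin n // ∀ P Q : ι, P ≤ Q → e P ≤ e Q }

/-- Give the label `0` to `r` and shift the labels of all other elements by one. -/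
def consEquiv {ι : Type*} [DecidableEq ι] {n : ℕ} (r : ι) (e : {x // x ≠ r} ≃ Fin n) :
    ι ≃ Fin (n + 1) where
  toFun x := if h : x = r then 0 else (e ⟨x, h⟩).succ
  invFun i := Fin.cases r (fun j => (e.symm j).1) i
  left_inv x := by
    by_cases h : x = r
    · simp [h]
    · simp [h]
  right_inv i := by
    cases i using Fin.cases with
    | zero => simp
    | succ j => simp [(e.symm j).2]

open Classical in
/-- The linear extensions in which a given root has the smallest label. -/
theorem card_linearExtension_fiber {ι : Type*} [Fintype ι] [PartialOrder ι] {n : ℕ} {r : ι}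
    (hr : IsMin r) :
    (Finset.univ.filter fun e : LinearExtension ι (n + 1) => e.1.symm 0 = r).card =
      Fintype.card (LinearExtension {x : ι // x ≠ r} n) := by
  rw [← Fintype.card_coe]
  symm
  have hF : ∀ e : LinearExtension {x : ι // x ≠ r} n,
      ∀ P Q : ι, P ≤ Q → consEquiv r e.1 P ≤ consEquiv r e.1 Q := by
    rintro ⟨e, he⟩ P Q hPQ
    by_cases hP : P = r
    · simp [consEquiv, hP]
    · have hQ : Q ≠ r := by
        rintro rfl
        exact hP (hr.eq_of_le hPQ)
      simpa [consEquiv, hP, hQ] using he ⟨P, hP⟩ ⟨Q, hQ⟩ hPQ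
  have hF' : ∀ e : LinearExtension {x : ι // x ≠ r} n,
      (⟨consEquiv r e.1, hF e⟩ : LinearExtension ι (n + 1)) ∈
        Finset.univ.filter fun e : LinearExtension ι (n + 1) => e.1.symm 0 = r := fun e => by
    simp [consEquiv]
  refine Fintype.card_of_bijective (f := fun e => ⟨⟨consEquiv r e.1, hF e⟩, hF' e⟩) ⟨?_, ?_⟩
  · rintro ⟨e, he⟩ ⟨e', he'⟩ h
    have h1 : consEquiv r e = consEquiv r e' := congrArg (fun x => x.1.1) h
    refine Subtype.ext (Equiv.ext fun x => ?_)
    have h2 := congrArg (fun f : ι ≃ Fin (n + 1) => f x.1) h1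
    simpa [consEquiv, x.2] using h2
  · rintro ⟨⟨e, he⟩, her⟩
    have her' : e r = 0 := by
      have : e.symm 0 = r := by simpa using her
      rw [← this, Equiv.apply_symm_apply]
    have hne : ∀ x : {x // x ≠ r}, e x.1 ≠ 0 := fun x hx =>
      x.2 (e.injective (hx.trans her'.symm))
    let e' : {x // x ≠ r} ≃ Fin n :=
      { toFun := fun x => (e x.1).pred (hne x)
        invFun := fun j => ⟨e.symm j.succ, fun h => by
          have := congrArg e h
          rw [Equiv.apply_symm_apply, her'] at this
          exact Fin.succ_ne_zero j this⟩
        left_inv := fun x => by simp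
        right_inv := fun j => by simp }
    have he' : ∀ P Q, P ≤ Q → e' P ≤ e' Q := fun P Q hPQ =>
      (Fin.pred_le_pred_iff (ha := hne P) (hb := hne Q)).2 (he P.1 Q.1 hPQ)
    refine ⟨⟨e', he'⟩, ?_⟩
    rw [Subtype.mk.injEq, Subtype.mk.injEq]
    refine Equiv.ext fun x => ?_
    by_cases hx : x = r
    · simp [consEquiv, hx, her']
    · simp [consEquiv, hx, e']

open Classical in
/-- In a finite forest every element lies above exactly one root. -/
theorem sum_card_filter_le_isMin {ι : Type*} [Fintype ι] [PartialOrder ι]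
    (forest : ∀ P Q R : ι, P ≤ R → Q ≤ R → P ≤ Q ∨ Q ≤ P) :
    ∑ r : ι with IsMin r, (Finset.univ.filter (r ≤ ·)).card = Fintype.card ι := by
  rw [← Finset.card_biUnion, ← Finset.card_univ]
  · congr 1
    rw [Finset.eq_univ_iff_forall]
    intro Q
    obtain ⟨r, hrQ, hr⟩ := Finset.exists_le_minimal (Finset.univ : Finset ι) (Finset.mem_univ Q)
    simp only [Finset.mem_biUnion, Finset.mem_filter, Finset.mem_univ, true_and]
    exact ⟨r, fun x hx => hr.2 (Finset.mem_univ x) hx, hrQ⟩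
  · intro r hr s hs hrs
    simp only [Finset.coe_filter, Finset.mem_univ, true_and, Set.mem_ofPred_eq] at hr hs
    refine Finset.disjoint_left.2 ?_
    intro Q hQ hQ'
    simp only [Finset.mem_filter, Finset.mem_univ, true_and] at hQ hQ'
    rcases forest r s Q hQ hQ' with h | h
    · exact hrs (hs.eq_of_le h)
    · exact hrs (hr.eq_of_le h).symm

open Classical in
/-- The hook length formula for forests. The element with the smallest label is a root, and removing
it does not change the set of elements above any other one. -/
theorem card_linearExtension_mul_prod {ι : Type*} [Fintype ι] [PartialOrder ι]
    (forest : ∀ P Q R : ι, P ≤ R → Q ≤ R → P ≤ Q ∨ Q ≤ P) {n : ℕ} (hn : Fintype.card ι = n) :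
    Fintype.card (LinearExtension ι n) * ∏ P : ι, (Finset.univ.filter (P ≤ ·)).card =
      n.factorial := by
  induction n generalizing ι with
  | zero =>
    have : IsEmpty ι := Fintype.card_eq_zero_iff.1 hn
    rw [Finset.univ_eq_empty, Finset.prod_empty, mul_one, Nat.factorial_zero,
      Fintype.card_eq_one_iff]
    exact ⟨⟨Equiv.equivOfIsEmpty ι (Fin 0), fun P => isEmptyElim P⟩, fun e =>
      Subtype.ext (Equiv.ext fun P => isEmptyElim P)⟩
  | succ n ih =>
    have hcard : Fintype.card (LinearExtension ι (n + 1)) =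
        ∑ r : ι with IsMin r, Fintype.card (LinearExtension {x : ι // x ≠ r} n) := by
      rw [← Finset.card_univ, Finset.card_eq_sum_card_fiberwise
        (f := fun e : LinearExtension ι (n + 1) => e.1.symm 0)
        (t := Finset.univ.filter fun r : ι => IsMin r)]
      · refine Finset.sum_congr rfl fun r hr => ?_
        exact card_linearExtension_fiber (Finset.mem_filter.1 hr).2
      · rintro ⟨e, he⟩ -
        simp only [Finset.coe_filter, Finset.mem_univ, true_and, Set.mem_ofPred_eq]
        intro P hP
        have h := he _ _ hP
        rw [Equiv.apply_symm_apply, Fin.le_zero_iff] at h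
        rw [← h, Equiv.symm_apply_apply]
    have hstep : ∀ r ∈ Finset.univ.filter (fun r : ι => IsMin r),
        Fintype.card (LinearExtension {x : ι // x ≠ r} n) *
          ∏ P : ι, (Finset.univ.filter (P ≤ ·)).card =
        n.factorial * (Finset.univ.filter (r ≤ ·)).card := by
      intro r hr
      replace hr := (Finset.mem_filter.1 hr).2
      have hc : Fintype.card {x : ι // x ≠ r} = n := by
        rw [Fintype.card_subtype_compl, Fintype.card_subtype_eq, hn, Nat.add_sub_cancel]
      have hup : ∀ P : {x : ι // x ≠ r}, (Finset.univ.filter (P.1 ≤ ·)).card =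
          (Finset.univ.filter (P ≤ ·)).card := by
        intro P
        rw [← Finset.card_map (Function.Embedding.subtype _)]
        congr 1
        ext Q
        have hQr : P.1 ≤ Q → Q ≠ r := by
          rintro hPQ rfl
          exact P.2 (hr.eq_of_le hPQ)
        simpa [← Subtype.coe_le_coe] using hQr
      have hprod : ∏ P : ι, (Finset.univ.filter (P ≤ ·)).card = (Finset.univ.filter (r ≤ ·)).card *
          ∏ P : {x : ι // x ≠ r}, (Finset.univ.filter (P ≤ ·)).card := by
        rw [Fintype.prod_eq_mul_prod_subtype_ne _ r]
        congr 1
        exact Finset.prod_congr (Finset.ext fun _ => by simp) fun P _ => hup P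
      rw [← ih (ι := {x : ι // x ≠ r}) (fun P Q R => forest P.1 Q.1 R.1) hc, hprod,
        mul_comm (Finset.card _), ← mul_assoc]
      congr!
    rw [hcard, Finset.sum_mul, Finset.sum_congr rfl hstep, ← Finset.mul_sum,
      sum_card_filter_le_isMin forest, hn, Nat.factorial_succ, mul_comm]

/-! ### The nesting forest -/

variable {n : ℕ} {γ : SetPartition n}

/-- Nesting is the inclusion of convex hulls. -/
theorem nestedLE_iff (hγ : IsNonCrossing γ) (P Q : {P // P ∈ γ.parts}) :
    NestedLE P.1 Q.1 ↔ P.1.min' (γ.nonempty_of_mem_parts P.2) ≤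
        Q.1.min' (γ.nonempty_of_mem_parts Q.2) ∧
      Q.1.max' (γ.nonempty_of_mem_parts Q.2) ≤ P.1.max' (γ.nonempty_of_mem_parts P.2) := by
  set p := P.1.min' (γ.nonempty_of_mem_parts P.2)
  set p' := P.1.max' (γ.nonempty_of_mem_parts P.2)
  set q := Q.1.min' (γ.nonempty_of_mem_parts Q.2)
  set q' := Q.1.max' (γ.nonempty_of_mem_parts Q.2)
  have hp : p ∈ P.1 := P.1.min'_mem _
  have hp' : p' ∈ P.1 := P.1.max'_mem _
  have hq : q ∈ Q.1 := Q.1.min'_mem _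
  have hq' : q' ∈ Q.1 := Q.1.max'_mem _
  constructor
  · rintro ⟨a, ha, b, hb, c, hc, hac, hcb⟩
    by_cases hPQ : P = Q
    · subst hPQ
      exact ⟨le_rfl, le_rfl⟩
    have hPQ' : P.1 ≠ Q.1 := fun h => hPQ (Subtype.ext h)
    have hne : ∀ x ∈ P.1, ∀ y ∈ Q.1, x ≠ y := fun x hx y hy h =>
      hPQ' (γ.eq_of_mem_parts P.2 Q.2 hx (h ▸ hy))
    have hac' := lt_of_le_of_ne hac (hne a ha c hc)
    have hcb' := lt_of_le_of_ne hcb (hne b hb c hc).symm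
    have hpa : p ≤ a := P.1.min'_le _ ha
    have hbp : b ≤ p' := P.1.le_max' _ hb
    constructor
    · by_contra h
      exact hγ Q.1 Q.2 P.1 P.2 hPQ'.symm ⟨q, hq, c, hc, p, hp, b, hb, not_le.1 h,
        hpa.trans_lt hac', hcb'⟩
    · by_contra h
      exact hγ P.1 P.2 Q.1 Q.2 hPQ' ⟨a, ha, p', hp', c, hc, q', hq', hac', hcb'.trans_le hbp,
        not_le.1 h⟩
  · rintro ⟨h1, h2⟩
    exact ⟨p, hp, p', hp', q, hq, h1, (Q.1.min'_le _ hq').trans h2⟩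

/-- The blocks of a non-crossing partition, as the vertices of its nesting forest. This is not
a subtype, which would carry the order by inclusion. -/
def Block (_ : IsNonCrossing γ) : Type := {P // P ∈ γ.parts}

instance (hγ : IsNonCrossing γ) : Fintype (Block hγ) :=
  inferInstanceAs (Fintype {P // P ∈ γ.parts})

/-- The partial order by nesting on the blocks of a non-crossing partition. -/
instance (hγ : IsNonCrossing γ) : PartialOrder (Block hγ) where
  le P Q := NestedLE P.1 Q.1
  le_refl P := (nestedLE_iff hγ P P).2 ⟨le_rfl, le_rfl⟩
  le_trans P Q R h h' := by
    have h1 := (nestedLE_iff hγ P Q).1 h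
    have h2 := (nestedLE_iff hγ Q R).1 h'
    exact (nestedLE_iff hγ P R).2 ⟨h1.1.trans h2.1, h2.2.trans h1.2⟩
  le_antisymm P Q h h' := by
    have h1 := (nestedLE_iff hγ P Q).1 h
    have h2 := (nestedLE_iff hγ Q P).1 h'
    refine Subtype.ext (γ.eq_of_mem_parts P.2 Q.2
      (P.1.min'_mem (γ.nonempty_of_mem_parts P.2)) ?_)
    rw [le_antisymm h1.1 h2.1]
    exact Q.1.min'_mem _

/-- If `R` is nested in `P` and `Q`, the one of these two which begins later begins before the other
one ends. -/
theorem nesting_forest (hγ : IsNonCrossing γ) (P Q R : {P // P ∈ γ.parts})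
    (hP : NestedLE P.1 R.1) (hQ : NestedLE Q.1 R.1) : NestedLE P.1 Q.1 ∨ NestedLE Q.1 P.1 := by
  rw [nestedLE_iff hγ] at hP hQ
  have hR := R.1.min'_le _ (R.1.max'_mem (γ.nonempty_of_mem_parts R.2))
  rcases le_total (P.1.min' (γ.nonempty_of_mem_parts P.2))
    (Q.1.min' (γ.nonempty_of_mem_parts Q.2)) with h | h
  · exact Or.inl ⟨_, P.1.min'_mem _, _, P.1.max'_mem _, _, Q.1.min'_mem _, h,
      hQ.1.trans (hR.trans hP.2)⟩
  · exact Or.inr ⟨_, Q.1.min'_mem _, _, Q.1.max'_mem _, _, P.1.min'_mem _, h,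
      hP.1.trans (hR.trans hQ.2)⟩

/-- The number of monotone labellings is `|γ|! / τ(γ)!`. -/
theorem monotoneLabellingCount_mul_treeFactorial (hγ : IsNonCrossing γ) :
    monotoneLabellingCount γ * treeFactorial γ = γ.parts.card.factorial := by
  classical
  have h1 : monotoneLabellingCount γ = Fintype.card (LinearExtension (Block hγ) γ.parts.card) :=
    Fintype.card_congr ⟨fun e => ⟨e.1, e.2⟩, fun e => ⟨e.1, e.2⟩, fun _ => rfl, fun _ => rfl⟩
  have h2 : ∀ P : Block hγ, (γ.parts.filter fun Q => NestedLE P.1 Q).card =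
      (Finset.univ.filter (P ≤ ·)).card := by
    intro P
    symm
    refine Finset.card_bij (fun Q _ => Q.1) (fun Q hQ => ?_) (fun _ _ _ _ h => Subtype.ext h)
      fun Q hQ => ?_
    · exact Finset.mem_filter.2 ⟨Q.2, (Finset.mem_filter.1 hQ).2⟩
    · obtain ⟨h1, h2⟩ := Finset.mem_filter.1 hQ
      exact ⟨⟨Q, h1⟩, Finset.mem_filter.2 ⟨Finset.mem_univ _, h2⟩, rfl⟩
  have h3 : treeFactorial γ = ∏ P : Block hγ, (Finset.univ.filter (P ≤ ·)).card := by
    rw [treeFactorial, ← Finset.prod_coe_sort]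
    exact Finset.prod_congr rfl fun P _ => h2 P
  rw [h1, h3]
  exact card_linearExtension_mul_prod (nesting_forest hγ) (Fintype.card_coe γ.parts)

end

/-! ### Monotone cumulants -/

section

variable {k A : Type*} [Field k] [Ring A] [Algebra k A]

theorem momentCharacter_word (φ : A →ₗ[k] k) {n : ℕ} (hn : 1 ≤ n) (a : Fin n → A) :
    momentCharacter φ (word k n a) = φ (List.ofFn a).prod := by
  obtain ⟨n, rfl⟩ : ∃ m, n = m + 1 := ⟨n - 1, by omega⟩
  have h : word k (n + 1) a = TensorAlgebra.ι k (DirectSum.lof k ℕ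
    (fun m : ℕ => ⨂[k]^(m + 1) A) n (PiTensorProduct.tprod k a)) := rfl
  rw [h, momentCharacter, TensorAlgebra.lift_ι_apply, DirectSum.toModule_lof,
    PiTensorProduct.lift.tprod]
  simp

theorem sum_monotonePartitions (h : (n : ℕ) → MultilinearMap k (fun _ : Fin n => A) k) {n : ℕ}
    (a : Fin n → A) :
    ∑ p ∈ (nonCrossingPartitions n).sigma fun π => (Finset.univ : Finset (MonotoneLabelling π)),
        ((p.1.parts.card.factorial : k)⁻¹) * blockProduct h p.1 a =
      ∑ γ ∈ nonCrossingPartitions n, ((γ.parts.card.factorial : k)⁻¹) *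
        ((monotoneLabellingCount γ : k) * blockProduct h γ a) := by
  rw [Finset.sum_sigma]
  refine Finset.sum_congr rfl fun γ _ => ?_
  simp only
  rw [Finset.sum_const, Finset.card_univ, nsmul_eq_mul, monotoneLabellingCount]
  ring

theorem sum_by_card {n : ℕ} (hn : 1 ≤ n) (F : SetPartition n → k) :
    ∑ s ∈ Finset.Icc 1 n, ((s.factorial : k)⁻¹) *
        ∑ γ ∈ nonCrossingPartitions n with γ.parts.card = s, F γ =
      ∑ γ ∈ nonCrossingPartitions n, ((γ.parts.card.factorial : k)⁻¹) * F γ := by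
  rw [← Finset.sum_fiberwise_of_maps_to (s := nonCrossingPartitions n) (t := Finset.Icc 1 n)
    (g := fun γ => γ.parts.card)]
  · refine Finset.sum_congr rfl fun s _ => ?_
    rw [Finset.mul_sum]
    refine Finset.sum_congr rfl fun γ hγ => ?_
    rw [(Finset.mem_filter.1 hγ).2]
  · intro γ _
    have h := γ.card_parts_le_card
    rw [Finset.card_univ, Fintype.card_fin] at h
    refine Finset.mem_Icc.2 ⟨Finset.card_pos.2 (γ.parts_nonempty ?_), h⟩
    exact (Finset.univ_nonempty_iff.2 ⟨⟨0, hn⟩⟩).ne_empty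

theorem treeFactorial_inv [CharZero k] {n : ℕ} {γ : SetPartition n} (hγ : IsNonCrossing γ) :
    ((treeFactorial γ : k)⁻¹) = ((γ.parts.card.factorial : k)⁻¹) * monotoneLabellingCount γ := by
  have h := congrArg (Nat.cast (R := k)) (monotoneLabellingCount_mul_treeFactorial hγ)
  have h0 : (γ.parts.card.factorial : k) ≠ 0 := Nat.cast_ne_zero.2 (Nat.factorial_ne_zero _)
  rw [Nat.cast_mul] at h
  have h1 : (treeFactorial γ : k) ≠ 0 := right_ne_zero_of_mul (h.symm ▸ h0)
  rw [← h]
  field_simp [left_ne_zero_of_mul (h.symm ▸ h0)]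

/-- Monotone cumulants are unique, as the moment of order `n` is the cumulant of order `n` plus a
function of cumulants of smaller order. -/
theorem IsMonotoneCumulantFamily.unique [CharZero k] {φ : A →ₗ[k] k}
    {h h' : (n : ℕ) → MultilinearMap k (fun _ : Fin n => A) k}
    (hh : IsMonotoneCumulantFamily φ h) (hh' : IsMonotoneCumulantFamily φ h') (n : ℕ) (hn : 1 ≤ n) :
    h n = h' n := by
  classical
  induction n using Nat.strong_induction_on with
  | _ n ih =>
    have hne : (Finset.univ : Finset (Fin n)) ≠ ∅ := (Finset.univ_nonempty_iff.2 ⟨⟨0, hn⟩⟩).ne_empty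
    -- The partition with a single block contributes the cumulant of order `n`.
    let γ₀ : SetPartition n := Finpartition.indiscrete hne
    have hparts : γ₀.parts = {Finset.univ} := rfl
    have hNC : IsNonCrossing γ₀ := by
      intro P hP Q hQ hPQ
      rw [hparts, Finset.mem_singleton] at hP hQ
      exact absurd (hP.trans hQ.symm) hPQ
    have hmem : γ₀ ∈ nonCrossingPartitions n := Finset.mem_filter.2 ⟨Finset.mem_univ _, hNC⟩
    have hcard : γ₀.parts.card = 1 := by rw [hparts, Finset.card_singleton]
    have hcount : monotoneLabellingCount γ₀ = 1 := by
      have h1 := monotoneLabellingCount_mul_treeFactorial hNC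
      rw [hcard, Nat.factorial_one] at h1
      exact Nat.eq_one_of_mul_eq_one_right h1
    have hblock : ∀ (g : (n : ℕ) → MultilinearMap k (fun _ : Fin n => A) k) (a : Fin n → A),
        blockProduct g γ₀ a = g n a := by
      intro g a
      rw [blockProduct, hparts, Finset.prod_singleton]
      have h1 : ∀ (m : ℕ) (hm : m = n) (b : Fin m → A), (∀ i, b i = a (Fin.cast hm i)) →
          g m b = g n a := by
        rintro m rfl b hb
        congr 1
        exact funext hb
      refine h1 _ (Finset.card_fin n) _ fun i => ?_
      rw [letters]
      congr 1
      have h2 := Finset.orderEmbOfFin_unique (s := (Finset.univ : Finset (Fin n))) rfl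
        (f := fun i => Fin.cast (Finset.card_fin n) i) (fun _ => Finset.mem_univ _)
        (fun i j hij => hij)
      exact (congrFun h2 i).symm
    have hsmall : ∀ γ : SetPartition n, γ ≠ γ₀ → ∀ a : Fin n → A,
        blockProduct h γ a = blockProduct h' γ a := by
      intro γ hγ a
      refine Finset.prod_congr rfl fun P hP => ?_
      have hlt : P.card < n := by
        have hle := P.card_le_univ
        rw [Fintype.card_fin] at hle
        refine lt_of_le_of_ne hle fun hPn => hγ (Finpartition.ext ?_)
        have hPu : P = Finset.univ := by
          rw [← Finset.card_eq_iff_eq_univ, hPn, Fintype.card_fin]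
        subst hPu
        rw [hparts]
        refine Finset.eq_singleton_iff_unique_mem.2 ⟨hP, fun Q hQ => ?_⟩
        obtain ⟨x, hx⟩ := γ.nonempty_of_mem_parts hQ
        exact γ.eq_of_mem_parts hQ hP hx (Finset.mem_univ x)
      rw [ih P.card hlt (Finset.card_pos.2 (γ.nonempty_of_mem_parts hP))]
    ext a
    have h1 := hh n hn a
    rw [hh' n hn a, sum_monotonePartitions, sum_monotonePartitions,
      ← Finset.add_sum_erase _ _ hmem, ← Finset.add_sum_erase _ _ hmem,
      Finset.sum_congr rfl fun γ hγ => by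
        rw [← hsmall γ (Finset.ne_of_mem_erase hγ) a], add_left_inj, hblock, hblock, hcard,
      hcount] at h1
    simpa using h1.symm

end

end

end MonotoneCumulants

open MonotoneCumulants in
theorem mainTheorem3 {k A : Type*} [Field k] [CharZero k] [Ring A] [Algebra k A]
    (φ : A →ₗ[k] k) (hφ : φ 1 = 1)
    (Φ : DoubleTensorAlgebra k A →ₗ[k] k) (hΦ : Φ = (momentCharacter φ).toLinearMap)
    (ρ : DoubleTensorAlgebra k A →ₗ[k] k) (hρ : ρ = convLog Φ) :
    (IsInfinitesimalCharacter ρ ∧ convExp ρ = Φ ∧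
      ∀ α : DoubleTensorAlgebra k A →ₗ[k] k,
        IsInfinitesimalCharacter α → convExp α = Φ → α = ρ) ∧
    (∀ n : ℕ, 1 ≤ n → ∀ a : Fin n → A,
      Φ (word k n a) =
          ∑ s ∈ Finset.Icc 1 n, ((s.factorial : k)⁻¹) *
            ∑ γ ∈ nonCrossingPartitions n with γ.parts.card = s,
              (monotoneLabellingCount γ : k) * blockProduct (formsOf ρ) γ a ∧
      Φ (word k n a) =
          ∑ γ ∈ nonCrossingPartitions n,
            ((treeFactorial γ : k)⁻¹) * blockProduct (formsOf ρ) γ a) ∧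
    (IsMonotoneCumulantFamily φ (formsOf ρ) ∧
      ∀ h : (n : ℕ) → MultilinearMap k (fun _ : Fin n => A) k,
        IsMonotoneCumulantFamily φ h → ∀ n : ℕ, 1 ≤ n → h n = formsOf ρ n) := by
  subst hρ
  have h1 : Φ 1 = 1 := by rw [hΦ]; exact map_one (momentCharacter φ)
  have hinf : IsInfinitesimalCharacter (convLog Φ) := by
    rw [hΦ]
    exact isInfinitesimalCharacter_convLog _
  have hexp : convExp (convLog Φ) = Φ := convExp_convLog h1
  have hmom : ∀ n : ℕ, 1 ≤ n → ∀ a : Fin n → A, Φ (word k n a) =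
      ∑ s ∈ Finset.Icc 1 n, ((s.factorial : k)⁻¹) *
        ∑ γ ∈ nonCrossingPartitions n with γ.parts.card = s,
          (monotoneLabellingCount γ : k) * blockProduct (formsOf (convLog Φ)) γ a := by
    intro n hn a
    rw [← convExp_word hinf hn, hexp]
  have hcum : IsMonotoneCumulantFamily φ (formsOf (convLog Φ)) := by
    intro n hn a
    rw [sum_monotonePartitions, ← sum_by_card hn, ← hmom n hn, hΦ, AlgHom.toLinearMap_apply,
      momentCharacter_word φ hn]
  refine ⟨⟨hinf, hexp, fun α hα hαΦ => convExp_injective hα.1 hinf.1 (hαΦ.trans hexp.symm)⟩,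
    fun n hn a => ⟨hmom n hn a, ?_⟩, hcum, fun h hh n hn => hh.unique hcum n hn⟩
  rw [hmom n hn, sum_by_card hn]
  refine Finset.sum_congr rfl fun γ hγ => ?_
  have hNC : IsNonCrossing γ := by simpa [nonCrossingPartitions] using hγ
  rw [treeFactorial_inv hNC, mul_assoc]
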